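/- **Setting.** Let $S$ be a finite set; in state $i\in S$ the actions are $0,1,\dots,d(i)$. Let $A_{ij}(a)>0$, $\sum_{j}A_{ij}(a)=1$, be the controlled transition probabilities and $c(i,a)$ a real cost. For angles $\alpha=(\alpha_{ip})_{i\in S,\,1\le p\le d(i)}$ let $$\theta_{ia}(\alpha)=\cos^2(\alpha_{i,a+1})\prod_{k=1}^{a}\sin^2(\alpha_{ik})\ (a<d(i)),\qquad \theta_{i,d(i)}(\alpha)=\prod_{k=1}^{d(i)}\sin^2(\alpha_{ik}),$$ and let $P(\alpha)$ be the transition matrix $P_{(i,a),(j,a')}(\alpha)=A_{ij}(a)\,\theta_{ja'}(\alpha)$ on state-action pairs, with unique invariant probability vector $\pi(\alpha)$. Put $C(\alpha)=\sum_{i,a}\pi_{i,a}(\alpha)c(i,a)$. Fix $\alpha$ with all $\alpha_{jq}\in(0,\pi/2)$, and fix $i\in S$ and $1\le p\le d(i)$. Let $Z_k=(X_k,u_k)$, $k\in\mathbb Z$, be the two-sided stationary Markov chain with transition matrix $P(\alpha)$ and marginal $\pi(\alpha)$; $\mathbb E$ and $\mathrm{Cov}$ refer to this stationary law. Let $(Y_k)_{k\in\mathbb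 Z}$ be i.i.d., independent of $Z$, with $\mathbb P(Y_k=a)=\theta_{ia}(\alpha)/\prod_{m=1}^{p}\sin^2(\alpha_{im})$ for $p\le a\le d(i)$. The phantom action is $\tilde u_k=Y_k$ if $p<d(i)$; if $p=d(i)$, it is $\tilde u_k=d(i)$ when $u_k=d(i)-1$, $\tilde u_k=d(i)-1$ when $u_k=d(i)$, and $0$ otherwise. Let $\nu(k)=\min\{m>0: Z_{k+m}=(i,\tilde u_k)\}$ and $$K_{ip}(\alpha,k)=\begin{cases}-\tan(\alpha_{ip})\,\mathbf 1\{Z_k=(i,p-1)\}, & p<d(i),\\ -\cos(\alpha_{ip})\sin(\alpha_{ip})\,\bigl[\mathbf 1\{Z_k=(i,p-1)\}-\mathbf 1\{Z_k=(i,p)\}\bigr], & p=d(i).\end{cases}$$ For a batch size $N\ge1$ and an integer $n$ let $I_n=\{nN+1,\dots,(n+1)N\}$, and let $\widehat\Gamma_n$ be any real function of $(Z_k)_{k\in I_n}$. With $D_n(k)=\mathbf 1\{k+\nu(k)\in I_n\}$ and $\mathcal L=\{k\le nN:\ k+\nu(k)>nN\}$, the fast weak-derivative phantom estimator over the batch is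 $$\widehat{\widehat G}_n(i,p)=\frac2N\Bigl[\sum_{k\in I_n}K_{ip}(\alpha,k)\Bigl(c(i,u_k)-c(i,\tilde u_k)+\sum_{j=k+1}^{\min\{k+\nu(k),(n+1)N\}}c(Z_j)-\nu(k)\widehat\Gamma_nD_n(k)\Bigr)+\sum_{k\in\mathcal L}K_{ip}(\alpha,k)\Bigl(\sum_{j=nN+1}^{\min\{k+\nu(k),(n+1)N\}}c(Z_j)-\nu(k)\widehat\Gamma_nD_n(k)\Bigr)\Bigr].$$ **Theorem.** Almost surely all $\nu(k)$ are finite and $\mathcal L$ is finite; $\widehat{\widehat G}_n(i,p)$ is integrable, and $C$ is differentiable in $\alpha_{ip}$ at $\alpha$. If $\widehat\Gamma_n$ is unbiased under the stationary law, $\mathbb E[\widehat\Gamma_n]=C(\alpha)$, then for every $N\ge 1$ and every $n$ $$\mathbb E\bigl[\widehat{\widehat G}_n(i,p)\bigr]-\frac{\partial C}{\partial\alpha_{ip}}(\alpha)=-\frac2N\sum_{k\in\mathbb Z}\mathrm{Cov}\Bigl(K_{ip}(\alpha,k)\,\nu(k)\,\mathbf 1\{k+\nu(k)\in I_n\},\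 \widehat\Gamma_n\Bigr),$$ the series being absolutely convergent. (The identity is exact: no $o(1/N)$ remainder is needed.) -/

import Mathlib

open MeasureTheory ProbabilityTheory
open scoped BigOperators

namespace PhantomMDP

/-- State-action pairs `(i, a)`: in state `i` the available actions are `0, 1, …, d i`. -/
abbrev StateAction {S : Type*} (d : S → ℕ) : Type _ := (i : S) × Fin (d i + 1)

/-- Control parameters: one angle for every state `i` and every `p = 1, …, d i`.
The index `p : Fin (d i)` stands for the angle number `p + 1` in the usual one-based numbering. -/
abbrev Angles {S : Type*} (d : S → ℕ) : Type _ := (i : S) → Fin (d i) → ℝ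

/-- The spherical coordinate number `a` of a vector of angles `β`, where `a = 0, …, m`:
`cos β_{a+1} * ∏_{k ≤ a} sin β_k` for `a < m`, and `∏_{k ≤ m} sin β_k` for `a = m`. -/
noncomputable def sphericalCoord {m : ℕ} (β : Fin m → ℝ) (a : Fin (m + 1)) : ℝ :=
  (if h : a.val < m then Real.cos (β ⟨a.val, h⟩) else 1) *
    ∏ k : Fin m, if k.val < a.val then Real.sin (β k) else 1

/-- Probability of choosing action `a` in state `i`, in spherical coordinates. -/
noncomputable def actionProb {S : Type*} {d : S → ℕ} (α : Angles d) (i : S)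
    (a : Fin (d i + 1)) : ℝ :=
  sphericalCoord (α i) a ^ 2

/-- `A i a j` is a controlled transition law: for every state-action pair `(i, a)` it is a
probability vector in `j`, all of whose entries are non-zero. -/
structure IsPositiveControlledLaw {S : Type*} [Fintype S] {d : S → ℕ}
    (A : (i : S) → Fin (d i + 1) → S → ℝ) : Prop where
  pos : ∀ i a j, 0 < A i a j
  sum_eq_one : ∀ i a, ∑ j, A i a j = 1

/-- One-step transition probabilities of the state-action chain `Z_n = (X_n, u_n)`. -/
noncomputable def transProb {S : Type*} {d : S → ℕ} (A : (i : S) → Fin (d i + 1) → S → ℝ)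
    (α : Angles d) (z z' : StateAction d) : ℝ :=
  actionProb α z'.1 z'.2 * A z.1 z.2 z'.1

/-- `π` is an invariant probability vector of the transition matrix `P`. -/
structure IsInvariantProb {E : Type*} [Fintype E] (P : E → E → ℝ) (π : E → ℝ) : Prop where
  nonneg : ∀ z, 0 ≤ π z
  sum_eq_one : ∑ z, π z = 1
  invariant : ∀ z', ∑ z, π z * P z z' = π z'

/-- The invariant probability vector of `P` (it exists and is unique for the chains
considered here). -/
noncomputable def invariantProb {E : Type*} [Fintype E] (P : E → E → ℝ) : E → ℝ :=
  Classical.epsilon (IsInvariantProb P)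

/-- The stationary cost `C(α) = ∑_{i,a} π_{i,a}(α) c(i,a)`. -/
noncomputable def stationaryCost {S : Type*} [Fintype S] {d : S → ℕ}
    (A : (i : S) → Fin (d i + 1) → S → ℝ) (c : StateAction d → ℝ) (α : Angles d) : ℝ :=
  ∑ z, invariantProb (transProb A α) z * c z

/-- The stationary cost as a function of the single angle `(i, p)`, the other angles being those
of `α`. -/
noncomputable def costAlong {S : Type*} [Fintype S] [DecidableEq S] {d : S → ℕ}
    (A : (i : S) → Fin (d i + 1) → S → ℝ) (c : StateAction d → ℝ) (α : Angles d)
    (i : S) (p : Fin (d i)) (x : ℝ) : ℝ :=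
  stationaryCost A c (Function.update α i (Function.update (α i) p x))

/-- Law of the phantom action for the angle `(i, p)`: the law of the action in state `i`
conditioned to be at least `p` (in one-based numbering of `p`). -/
noncomputable def phantomLaw {S : Type*} {d : S → ℕ} (α : Angles d) (i : S) (p : Fin (d i))
    (a : Fin (d i + 1)) : ℝ :=
  if p.val + 1 ≤ a.val then
    actionProb α i a / ∏ m : Fin (d i), (if m.val ≤ p.val then Real.sin (α i m) ^ 2 else 1)
  else 0

/-- `Z` is the two-sided stationary state-action chain with parameter `α`, and `Y` is an i.i.d.
sequence of phantom actions for the angle `(i, p)`, independent of `Z`. -/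
structure IsStationaryPhantomSystem {S : Type*} [Fintype S] {d : S → ℕ}
    (A : (i : S) → Fin (d i + 1) → S → ℝ) (α : Angles d) (i : S) (p : Fin (d i))
    {Ω : Type*} [MeasurableSpace Ω] (μ : Measure Ω)
    (Z : ℤ → Ω → StateAction d) (Y : ℤ → Ω → Fin (d i + 1)) : Prop where
  measurable_chain : ∀ k, Measurable (Z k)
  measurable_phantom : ∀ k, Measurable (Y k)
  /-- finite-dimensional laws of a stationary Markov chain -/
  chain_law : ∀ (k : ℤ) (l : ℕ) (z : ℕ → StateAction d),
    μ.real {ω | ∀ t ≤ l, Z (k + (t : ℤ)) ω = z t} =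
      invariantProb (transProb A α) (z 0) *
        ∏ t ∈ Finset.range l, transProb A α (z t) (z (t + 1))
  phantom_law : ∀ (k : ℤ) (a : Fin (d i + 1)),
    μ.real {ω | Y k ω = a} = phantomLaw α i p a
  phantom_indep : iIndepFun Y μ
  chain_indep_phantom : IndepFun (fun ω k => Z k ω) (fun ω k => Y k ω) μ

section Estimator

variable {S : Type*} {d : S → ℕ} {Ω : Type*}

/-- The phantom action started at time `k`: it is `Y k`, except for the last angle of state `i`,
where the actions `d i - 1` and `d i` are exchanged. -/
def phantomAction (i : S) (p : Fin (d i)) (Z : ℤ → Ω → StateAction d)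
    (Y : ℤ → Ω → Fin (d i + 1)) (k : ℤ) (ω : Ω) : Fin (d i + 1) :=
  if p.val + 1 < d i then Y k ω
  else if (Z k ω).2.val = p.val then p.succ
  else if (Z k ω).2.val = p.val + 1 then p.castSucc
  else 0

/-- The hitting time `ν(k) = min {m > 0 : Z_{k+m} = (i, ũ_k)}`. -/
noncomputable def hittingTime (i : S) (p : Fin (d i)) (Z : ℤ → Ω → StateAction d)
    (Y : ℤ → Ω → Fin (d i + 1)) (k : ℤ) (ω : Ω) : ℕ :=
  sInf {m : ℕ | 0 < m ∧ Z (k + (m : ℤ)) ω = ⟨i, phantomAction i p Z Y k ω⟩}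

/-- The weight `K_{ip}(α, k)`, as a function of the value `z` of `Z_k`. -/
noncomputable def weight [DecidableEq S] (α : Angles d) (i : S) (p : Fin (d i))
    (z : StateAction d) : ℝ :=
  if p.val + 1 < d i then
    -Real.tan (α i p) * (if z = ⟨i, p.castSucc⟩ then 1 else 0)
  else
    -(Real.cos (α i p) * Real.sin (α i p)) *
      ((if z = ⟨i, p.castSucc⟩ then 1 else 0) - (if z = ⟨i, p.succ⟩ then 1 else 0))

/-- The batch `I_n = {nN + 1, …, (n + 1)N}`. -/
noncomputable def batch (N : ℕ) (n : ℤ) : Finset ℤ := Finset.Icc (n * N + 1) ((n + 1) * N)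

/-- An estimator of the cost computed from the trajectory observed during batch `n`. -/
def batchCostEstimator {N : ℕ} (Γ : (Fin N → StateAction d) → ℝ) (n : ℤ)
    (Z : ℤ → Ω → StateAction d) (ω : Ω) : ℝ :=
  Γ fun t => Z (n * N + 1 + (t.val : ℤ)) ω

/-- The list of phantoms that are living at time `j`. -/
def livingPhantoms (i : S) (p : Fin (d i)) (Z : ℤ → Ω → StateAction d)
    (Y : ℤ → Ω → Fin (d i + 1)) (j : ℤ) (ω : Ω) : Set ℤ :=
  {k | k ≤ j ∧ j < k + (hittingTime i p Z Y k ω : ℤ)}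

/-- What phantom `k` receives during batch `n` from time `s` on, after its initial contribution:
the costs `c(Z_j)` for `s ≤ j ≤ min (k + ν(k), (n + 1)N)`, minus `ν(k) Γ̂_n` if it dies
in batch `n`. -/
noncomputable def phantomGain (c : StateAction d → ℝ) (i : S) (p : Fin (d i)) {N : ℕ}
    (Γ : (Fin N → StateAction d) → ℝ) (n : ℤ) (Z : ℤ → Ω → StateAction d)
    (Y : ℤ → Ω → Fin (d i + 1)) (k s : ℤ) (ω : Ω) : ℝ :=
  (∑ j ∈ Finset.Icc s (min (k + (hittingTime i p Z Y k ω : ℤ)) ((n + 1) * N)), c (Z j ω)) -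
    hittingTime i p Z Y k ω * batchCostEstimator Γ n Z ω *
      (if k + (hittingTime i p Z Y k ω : ℤ) ∈ batch N n then 1 else 0)

/-- The fast phantom estimator of the partial derivative of the stationary cost with respect to
the angle `(i, p)`, computed over batch `n` of size `N`. In the first sum `c (Z k ω)` is
`c (i, u_k)` whenever the weight is non-zero. -/
noncomputable def fastPhantomEstimator [DecidableEq S] (c : StateAction d → ℝ) (α : Angles d)
    (i : S) (p : Fin (d i)) {N : ℕ} (Γ : (Fin N → StateAction d) → ℝ) (n : ℤ)
    (Z : ℤ → Ω → StateAction d) (Y : ℤ → Ω → Fin (d i + 1)) (ω : Ω) : ℝ :=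
  2 / (N : ℝ) *
    ((∑ k ∈ batch N n, weight α i p (Z k ω) *
        (c (Z k ω) - c ⟨i, phantomAction i p Z Y k ω⟩ +
          phantomGain c i p Γ n Z Y k (k + 1) ω)) +
      ∑' k : livingPhantoms i p Z Y (n * N) ω, weight α i p (Z k ω) *
        phantomGain c i p Γ n Z Y k (n * N + 1) ω)

end Estimator

end PhantomMDP

set_option linter.unusedSectionVars false

/-! Write P, π, C for the transition matrix, its invariant law and the stationary cost, and let h
solve the Poisson equation h - Ph = c - C.

Derivative. If ρ is invariant for Q, then ρ(c) - π(c) = ρ(Q - P)h exactly (`invariant_mean_sub`), so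
the derivative of the cost is πP'h. Only the action probabilities in state i move: mass leaves
`p.castSucc` at rate 2 tan(α_ip) θ and is redistributed by the phantom law
(`hasDerivAt_actionProb`). Hence the derivative is 2 E[K (h(Z_k) - h(w))], with w the phantom's
target (`sum_weight_mul_eq`). Since h = c - C + Ph, this equals 2(R + V), where R = E[K (c(Z_k) -
c(w))] and V = E[K (Ph(Z_k) - Ph(w))].

Phantoms. Started at z, the expected sum of c - C up to the first visit to w is Ph(z) - Ph(w), by
telescoping the kernel killed at w (`hasSum_tabooApply_iterate`). By stationarity, summing over all
birth times k what phantoms collect at one fixed time j reproduces the whole life of one phantom,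
namely V + Cκ with κ = E[Kν] (`hasSum_integral_occupation`). Likewise the weighted lifetimes of the
phantoms that die at time j have total mean κ (`hasSum_integral_lifetimeAt`).

Conclusion. Once the estimator is a sum over all integers k (`hasSum_batchGain`), its mean is
(2/N)(NR + N(V + Cκ) - Σ E[KνDΓ]), while Σ E[KνD] = Nκ. As E[Γ] = C, the term NCκ is exactly Σ
E[KνD] E[Γ], and only covariances remain. All interchanges rest on geometric tails: each step hits w
with probability at least the smallest entry of P. -/

namespace PhantomMDP

/-! ### Positive stochastic matrices: invariant law, Poisson equation, taboo kernel -/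

section StochasticMatrix

variable {E : Type*} [Fintype E]

/-- A stochastic matrix all of whose entries are positive. -/
structure IsPositiveStochastic (P : E → E → ℝ) : Prop where
  pos : ∀ z z', 0 < P z z'
  sum_eq_one : ∀ z, ∑ z', P z z' = 1

/-- The action of a kernel on functions. -/
def kernelApply (P : E → E → ℝ) (f : E → ℝ) (z : E) : ℝ := ∑ z', P z z' * f z'

/-- The action on functions of a kernel that is killed on hitting `w`. -/
def tabooApply [DecidableEq E] (P : E → E → ℝ) (w : E) (f : E → ℝ) (z : E) : ℝ :=
  ∑ z', P z z' * (if z' = w then 0 else f z')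

theorem sum_invariant_mul_kernelApply {P : E → E → ℝ} {π : E → ℝ} (hπ : IsInvariantProb P π)
    (f : E → ℝ) : ∑ z, π z * kernelApply P f z = ∑ z, π z * f z := by
  simp only [kernelApply, Finset.mul_sum]
  rw [Finset.sum_comm]
  refine Finset.sum_congr rfl fun z' _ => ?_
  rw [← hπ.invariant z', Finset.sum_mul]
  exact Finset.sum_congr rfl fun z _ => by ring

variable {P : E → E → ℝ}

/-- The constants lie in the right kernel of P - 1, so there is a left null vector v. Then |v| ≤
|v|P entrywise with equal total masses, which forces equality; normalise |v|. -/
theorem IsPositiveStochastic.exists_isInvariantProb [Nonempty E] (hP : IsPositiveStochastic P) :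
    ∃ π, IsInvariantProb P π := by
  classical
  have hdet : (Matrix.of P - 1 : Matrix E E ℝ).det = 0 := by
    rw [← Matrix.exists_mulVec_eq_zero_iff]
    refine ⟨fun _ => 1, fun h => one_ne_zero (congrFun h (Classical.arbitrary E)), ?_⟩
    ext z
    simp [Matrix.mulVec, dotProduct, hP.sum_eq_one, Matrix.one_apply]
  obtain ⟨v, hv0, hv⟩ := Matrix.exists_vecMul_eq_zero_iff.2 hdet
  have hv' : ∀ z', ∑ z, v z * P z z' = v z' := fun z' => by
    have := congrFun hv z'
    rw [Matrix.vecMul_sub, Matrix.vecMul_one] at this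
    simpa [Matrix.vecMul, dotProduct, sub_eq_zero] using this
  have hle : ∀ z' ∈ Finset.univ, |v z'| ≤ ∑ z, |v z| * P z z' := fun z' _ => by
    conv_lhs => rw [← hv' z']
    refine (Finset.abs_sum_le_sum_abs _ _).trans_eq (Finset.sum_congr rfl fun z _ => ?_)
    rw [abs_mul, abs_of_pos (hP.pos _ _)]
  have hsum : ∑ z', |v z'| = ∑ z', ∑ z, |v z| * P z z' := by
    rw [Finset.sum_comm]
    simp [← Finset.mul_sum, hP.sum_eq_one]
  have heq := (Finset.sum_eq_sum_iff_of_le hle).1 hsum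
  have hpos : 0 < ∑ z, |v z| := by
    obtain ⟨z, hz⟩ := Function.ne_iff.1 hv0
    exact Finset.sum_pos' (fun _ _ => abs_nonneg _) ⟨z, Finset.mem_univ _, abs_pos.2 hz⟩
  refine ⟨fun z => |v z| / ∑ z, |v z|, fun z => by positivity, ?_, fun z' => ?_⟩
  · rw [← Finset.sum_div, div_self hpos.ne']
  · rw [heq z' (Finset.mem_univ _), Finset.sum_div]
    exact Finset.sum_congr rfl fun z _ => by ring

theorem IsPositiveStochastic.isInvariantProb_invariantProb [Nonempty E]
    (hP : IsPositiveStochastic P) : IsInvariantProb P (invariantProb P) :=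
  Classical.epsilon_spec hP.exists_isInvariantProb

/-- Maximum principle: at a maximiser m, the nonnegative function h m - h has mean zero under a row
with positive entries, hence vanishes. -/
theorem IsPositiveStochastic.eq_of_kernelApply_eq_self (hP : IsPositiveStochastic P)
    {h : E → ℝ} (hh : ∀ z, kernelApply P h z = h z) (z w : E) : h z = h w := by
  obtain ⟨m, -, hm⟩ := Finset.exists_max_image Finset.univ h ⟨z, Finset.mem_univ _⟩
  suffices H : ∀ z, h z = h m by rw [H z, H w]
  intro z
  have hsum : ∑ z', P m z' * (h m - h z') = 0 := by
    simp only [mul_sub, Finset.sum_sub_distrib, ← Finset.sum_mul, hP.sum_eq_one, one_mul]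
    exact sub_eq_zero.2 (hh m).symm
  have := (Finset.sum_eq_zero_iff_of_nonneg fun z' _ =>
    mul_nonneg (hP.pos m z').le (sub_nonneg.2 (hm z' (Finset.mem_univ _)))).1 hsum z
      (Finset.mem_univ _)
  have := (mul_eq_zero.1 this).resolve_left (hP.pos m z).ne'
  linarith

/-- The Poisson equation of a positive stochastic matrix is solvable. -/
theorem IsPositiveStochastic.exists_poisson (hP : IsPositiveStochastic P) {π : E → ℝ}
    (hπ : IsInvariantProb P π) (f : E → ℝ) :
    ∃ h : E → ℝ, ∀ z, h z - kernelApply P h z = f z - ∑ y, π y * f y := by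
  -- The rank-one term π removes the constants from the kernel of 1 - P. Since π(Lh) = π(h), solving
  -- Lh = f gives π(h) = π(f), which is the constant in the Poisson equation.
  let L : (E → ℝ) →ₗ[ℝ] (E → ℝ) :=
    { toFun := fun h z => h z - kernelApply P h z + ∑ y, π y * h y
      map_add' := fun g h => by
        ext z; simp only [kernelApply, Pi.add_apply, mul_add, Finset.sum_add_distrib]; ring
      map_smul' := fun r h => by
        ext z
        simp only [kernelApply, Pi.smul_apply, smul_eq_mul, RingHom.id_apply, mul_add, mul_sub,
          Finset.mul_sum]
        simp only [mul_left_comm] }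
  have hL : ∀ h z, L h z = h z - kernelApply P h z + ∑ y, π y * h y := fun _ _ => rfl
  have hmean : ∀ h, ∑ z, π z * L h z = ∑ z, π z * h z := fun h => by
    simp only [hL, mul_add, mul_sub, Finset.sum_add_distrib, Finset.sum_sub_distrib,
      sum_invariant_mul_kernelApply hπ, ← Finset.sum_mul, hπ.sum_eq_one]
    ring
  have hinj : Function.Injective L := by
    rw [← LinearMap.ker_eq_bot, LinearMap.ker_eq_bot']
    intro h h0
    have hm : ∑ z, π z * h z = 0 := by rw [← hmean, h0]; simp
    have hharm : ∀ z, kernelApply P h z = h z := fun z => by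
      have := congrFun h0 z
      rw [hL, hm] at this
      simp only [Pi.zero_apply] at this
      linarith
    ext w
    have : ∑ z, π z * h z = h w := by
      simp only [hP.eq_of_kernelApply_eq_self hharm _ w, ← Finset.sum_mul, hπ.sum_eq_one, one_mul]
    rw [← this, hm]; rfl
  obtain ⟨h, hh⟩ := LinearMap.injective_iff_surjective.1 hinj f
  refine ⟨h, fun z => ?_⟩
  have h1 := hmean h
  rw [hh] at h1
  have h2 := hL h z
  rw [hh] at h2
  linarith

/-- The probability of not hitting a point in one step is bounded away from one. -/
theorem IsPositiveStochastic.exists_taboo_bound [DecidableEq E] [Nonempty E]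
    (hP : IsPositiveStochastic P) :
    ∃ r : ℝ, 0 ≤ r ∧ r < 1 ∧ ∀ w z, ∑ z', P z z' * (if z' = w then 0 else 1) ≤ r := by
  obtain ⟨m, hm⟩ := Finite.exists_min fun q : E × E => P q.1 q.2
  have key : ∀ w z, ∑ z', P z z' * (if z' = w then 0 else 1) = 1 - P z w := fun w z => by
    have hsum := hP.sum_eq_one z
    rw [← Finset.add_sum_erase _ _ (Finset.mem_univ w)] at hsum ⊢
    simp only [if_true, mul_zero, zero_add]
    refine Eq.trans ?_ (eq_sub_of_add_eq' hsum)
    exact Finset.sum_congr rfl fun z' hz' => by simp [Finset.ne_of_mem_erase hz']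
  -- The bound is one minus the smallest entry of P, so it serves all targets at once.
  refine ⟨1 - P m.1 m.2, ?_, by linarith [hP.pos m.1 m.2], fun w z => ?_⟩
  · rw [← key]
    exact Finset.sum_nonneg fun z' _ => mul_nonneg (hP.pos _ _).le (by split_ifs <;> norm_num)
  · rw [key]; linarith [hm (z, w)]

theorem IsPositiveStochastic.abs_tabooApply_le [DecidableEq E] (hP : IsPositiveStochastic P)
    {r : ℝ} (hr : ∀ w z, ∑ z', P z z' * (if z' = w then 0 else 1) ≤ r)
    {f : E → ℝ} {M : ℝ} (hM : 0 ≤ M) (hf : ∀ z, |f z| ≤ M) (w z : E) :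
    |tabooApply P w f z| ≤ r * M := by
  refine (Finset.abs_sum_le_sum_abs _ _).trans ?_
  refine le_trans ?_ (mul_le_mul_of_nonneg_right (hr w z) hM)
  rw [Finset.sum_mul]
  refine Finset.sum_le_sum fun z' _ => ?_
  rw [abs_mul, abs_of_pos (hP.pos _ _), mul_assoc]
  refine mul_le_mul_of_nonneg_left ?_ (hP.pos _ _).le
  split_ifs <;> simp [hf z']

theorem IsPositiveStochastic.abs_tabooApply_iterate_le [DecidableEq E]
    (hP : IsPositiveStochastic P) {r : ℝ} (hr0 : 0 ≤ r)
    (hr : ∀ w z, ∑ z', P z z' * (if z' = w then 0 else 1) ≤ r)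
    {f : E → ℝ} {M : ℝ} (hM : 0 ≤ M) (hf : ∀ z, |f z| ≤ M) (w : E) (m : ℕ) (z : E) :
    |(tabooApply P w)^[m] f z| ≤ r ^ m * M := by
  induction m generalizing z with
  | zero => simpa using hf z
  | succ m ih =>
    rw [Function.iterate_succ_apply', pow_succ', mul_assoc]
    exact hP.abs_tabooApply_le hr (by positivity) ih w z

theorem tabooApply_sub [DecidableEq E] (P : E → E → ℝ) (w : E) (f g : E → ℝ) :
    tabooApply P w (f - g) = tabooApply P w f - tabooApply P w g := by
  ext z
  simp only [tabooApply, Pi.sub_apply, ← Finset.sum_sub_distrib]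
  exact Finset.sum_congr rfl fun z' _ => by split_ifs <;> ring

theorem tabooApply_iterate_sub [DecidableEq E] (P : E → E → ℝ) (w : E) (m : ℕ) (f g : E → ℝ) :
    (tabooApply P w)^[m] (f - g) = (tabooApply P w)^[m] f - (tabooApply P w)^[m] g := by
  induction m generalizing f g with
  | zero => rfl
  | succ m ih => simp only [Function.iterate_succ_apply, tabooApply_sub, ih]

theorem tabooApply_smul [DecidableEq E] (P : E → E → ℝ) (w : E) (r : ℝ) (f : E → ℝ) :
    tabooApply P w (r • f) = r • tabooApply P w f := by
  ext z
  simp only [tabooApply, Pi.smul_apply, smul_eq_mul, Finset.mul_sum]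
  exact Finset.sum_congr rfl fun z' _ => by split_ifs <;> ring

theorem tabooApply_iterate_smul [DecidableEq E] (P : E → E → ℝ) (w : E) (m : ℕ) (r : ℝ)
    (f : E → ℝ) : (tabooApply P w)^[m] (r • f) = r • (tabooApply P w)^[m] f := by
  induction m generalizing f with
  | zero => rfl
  | succ m ih => simp only [Function.iterate_succ_apply, tabooApply_smul, ih]

/-- The expected sum of `f` up to the hitting time of `w`, for a solution `h` of the Poisson
equation `h - P h = f`. -/
theorem IsPositiveStochastic.hasSum_tabooApply_iterate [DecidableEq E] [Nonempty E]
    (hP : IsPositiveStochastic P) {f h : E → ℝ} (hh : ∀ z, h z - kernelApply P h z = f z)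
    (w z : E) :
    HasSum (fun m => (tabooApply P w)^[m] (kernelApply P f) z)
      (kernelApply P h z - kernelApply P h w) := by
  obtain ⟨r, hr0, hr1, hr⟩ := hP.exists_taboo_bound
  set g : E → ℝ := fun z => kernelApply P h z - kernelApply P h w with hg
  -- Because g vanishes at w, killing at w does not change Pg, so Pf = g - Tg with T the taboo
  -- kernel, and the series of iterates telescopes.
  have hPf : kernelApply P f = g - tabooApply P w g := by
    ext z
    have h1 : tabooApply P w g z = kernelApply P g z :=
      Finset.sum_congr rfl fun z' _ => by
        split_ifs with hz
        · simp [hg, hz]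
        · rfl
    have h2 : kernelApply P g z = kernelApply P (kernelApply P h) z - kernelApply P h w := by
      simp only [hg, kernelApply, mul_sub, Finset.sum_sub_distrib, ← Finset.sum_mul,
        hP.sum_eq_one, one_mul]
    have h3 : kernelApply P f z = kernelApply P h z - kernelApply P (kernelApply P h) z := by
      rw [show f = fun z => h z - kernelApply P h z from funext fun z => (hh z).symm]
      conv_lhs => rw [kernelApply]
      simp only [mul_sub, Finset.sum_sub_distrib]
      rfl
    rw [Pi.sub_apply, h1, h2, h3, hg]
    ring
  have hterm : ∀ m, (tabooApply P w)^[m] (kernelApply P f) z =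
      (tabooApply P w)^[m] g z - (tabooApply P w)^[m + 1] g z := fun m => by
    rw [hPf, tabooApply_iterate_sub, Function.iterate_succ_apply]; rfl
  obtain ⟨M, hM⟩ : ∃ M, ∀ z, |g z| ≤ M :=
    ⟨∑ z, |g z|, fun z => Finset.single_le_sum (f := fun z => |g z|)
      (fun _ _ => abs_nonneg _) (Finset.mem_univ z)⟩
  have hM0 : 0 ≤ M := (abs_nonneg _).trans (hM z)
  have hbound := hP.abs_tabooApply_iterate_le hr0 hr hM0 hM w
  have hgeo := (summable_geometric_of_lt_one hr0 hr1).mul_right M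
  have hs : Summable fun m => (tabooApply P w)^[m] g z :=
    Summable.of_norm_bounded hgeo fun m => hbound m z
  have hs' : Summable fun m => (tabooApply P w)^[m] (kernelApply P f) z := by
    simp only [hterm]
    exact hs.sub ((summable_nat_add_iff 1).2 hs)
  rw [hs'.hasSum_iff_tendsto_nat]
  simp only [hterm, Finset.sum_range_sub']
  simpa [hg] using (tendsto_const_nhds (x := g z)).sub hs.tendsto_atTop_zero

end StochasticMatrix

/-! ### Spherical coordinates as functions of one angle -/

section SphericalCoordinates

theorem sum_sphericalCoord_sq {m : ℕ} (β : Fin m → ℝ) :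
    ∑ a, sphericalCoord β a ^ 2 = 1 := by
  induction m with
  | zero => simp [sphericalCoord]
  | succ m ih =>
    have h0 : sphericalCoord β 0 = Real.cos (β 0) := by simp [sphericalCoord]
    have hs : ∀ a : Fin (m + 1), sphericalCoord β a.succ =
        Real.sin (β 0) * sphericalCoord (fun k => β k.succ) a := fun a => by
      simp only [sphericalCoord, Fin.prod_univ_succ, Fin.val_succ, Fin.val_zero, Nat.succ_pos,
        Nat.add_lt_add_iff_right, if_true, Fin.succ_mk]
      ring
    rw [Fin.sum_univ_succ, h0]
    simp only [hs, mul_pow, ← Finset.mul_sum, ih]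
    rw [mul_one, Real.cos_sq_add_sin_sq]

theorem sphericalCoord_pos {m : ℕ} {β : Fin m → ℝ} (hβ : ∀ k, β k ∈ Set.Ioo 0 (Real.pi / 2))
    (a : Fin (m + 1)) : 0 < sphericalCoord β a := by
  have hsin : ∀ k, 0 < Real.sin (β k) := fun k =>
    Real.sin_pos_of_pos_of_lt_pi (hβ k).1 (by linarith [(hβ k).2, Real.pi_pos])
  have hcos : ∀ k, 0 < Real.cos (β k) := fun k =>
    Real.cos_pos_of_mem_Ioo ⟨by linarith [(hβ k).1, Real.pi_pos], (hβ k).2⟩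
  refine mul_pos ?_ (Finset.prod_pos fun k _ => ?_)
  · split_ifs
    exacts [hcos _, one_pos]
  · split_ifs
    exacts [hsin _, one_pos]

variable {m : ℕ} (β : Fin m → ℝ) (p : Fin m)

/-- The product of the sines of the angles that precede `p`. -/
noncomputable def sinProdBefore : ℝ := ∏ k : Fin m, if k.val < p.val then Real.sin (β k) else 1

/-- First of three cases: as a function of angle p alone, coordinate a is constant, a multiple of
cos or a multiple of sin, according as a is below, at or above p. -/
theorem sphericalCoord_update_of_lt (x : ℝ) {a : Fin (m + 1)} (ha : a.val < p.val) :
    sphericalCoord (Function.update β p x) a = sphericalCoord β a := by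
  have hne : ∀ k : Fin m, k.val ≤ a.val → Function.update β p x k = β k := fun k hk =>
    Function.update_of_ne (fun h => by subst h; omega) _ _
  unfold sphericalCoord
  congr 1
  · split_ifs
    · rw [hne _ le_rfl]
    · rfl
  · refine Finset.prod_congr rfl fun k _ => ?_
    split_ifs with hk
    · rw [hne _ hk.le]
    · rfl

theorem sphericalCoord_update_castSucc (x : ℝ) :
    sphericalCoord (Function.update β p x) p.castSucc = Real.cos x * sinProdBefore β p := by
  unfold sphericalCoord sinProdBefore
  congr 1
  · simp
  · refine Finset.prod_congr rfl fun k _ => ?_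
    simp only [Fin.val_castSucc]
    split_ifs with hk
    · rw [Function.update_of_ne (fun h => by subst h; omega)]
    · rfl

theorem exists_sphericalCoord_update_of_gt {a : Fin (m + 1)} (ha : p.val < a.val) :
    ∃ R, ∀ x, sphericalCoord (Function.update β p x) a = Real.sin x * R := by
  refine ⟨(if h : a.val < m then Real.cos (β ⟨a.val, h⟩) else 1) *
    ∏ k ∈ Finset.univ.erase p, if k.val < a.val then Real.sin (β k) else 1, fun x => ?_⟩
  unfold sphericalCoord
  rw [← Finset.mul_prod_erase _ _ (Finset.mem_univ p), if_pos ha, Function.update_self,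
    mul_left_comm]
  congr 2
  · split_ifs with h
    · rw [Function.update_of_ne (fun h => by
        have := congrArg Fin.val h
        simp only at this
        omega)]
    · rfl
  · refine Finset.prod_congr rfl fun k hk => ?_
    rw [Function.update_of_ne (Finset.ne_of_mem_erase hk)]

theorem prod_sin_sq_eq : (∏ k : Fin m, if k.val ≤ p.val then Real.sin (β k) ^ 2 else 1) =
    Real.sin (β p) ^ 2 * sinProdBefore β p ^ 2 := by
  unfold sinProdBefore
  rw [← Finset.mul_prod_erase _ _ (Finset.mem_univ p), if_pos le_rfl,
    ← Finset.mul_prod_erase _ (fun k : Fin m => if k.val < p.val then Real.sin (β k) else 1)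
      (Finset.mem_univ p), if_neg (lt_irrefl _), one_mul, ← Finset.prod_pow]
  congr 1
  refine Finset.prod_congr rfl fun k hk => ?_
  have : k.val ≠ p.val := fun h => Finset.ne_of_mem_erase hk (Fin.ext h)
  by_cases hlt : k.val < p.val
  · rw [if_pos hlt, if_pos hlt.le]
  · rw [if_neg hlt, if_neg (by omega), one_pow]

end SphericalCoordinates

/-! ### Action probabilities, phantom law and their derivatives -/

section ActionProb

variable {S : Type*} {d : S → ℕ} {α : Angles d}

theorem sum_actionProb (α : Angles d) (i : S) : ∑ a, actionProb α i a = 1 :=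
  sum_sphericalCoord_sq _

theorem actionProb_pos (hα : ∀ i p, α i p ∈ Set.Ioo 0 (Real.pi / 2)) (i : S)
    (a : Fin (d i + 1)) : 0 < actionProb α i a :=
  pow_pos (sphericalCoord_pos (hα i) a) 2

theorem sin_pos_of_angle (hα : ∀ i p, α i p ∈ Set.Ioo 0 (Real.pi / 2)) (i : S) (p : Fin (d i)) :
    0 < Real.sin (α i p) :=
  Real.sin_pos_of_pos_of_lt_pi (hα i p).1 (by linarith [(hα i p).2, Real.pi_pos])

theorem cos_pos_of_angle (hα : ∀ i p, α i p ∈ Set.Ioo 0 (Real.pi / 2)) (i : S) (p : Fin (d i)) :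
    0 < Real.cos (α i p) :=
  Real.cos_pos_of_mem_Ioo ⟨by linarith [(hα i p).1, Real.pi_pos], (hα i p).2⟩

theorem actionProb_castSucc (i : S) (p : Fin (d i)) :
    actionProb α i p.castSucc = Real.cos (α i p) ^ 2 * sinProdBefore (α i) p ^ 2 := by
  rw [actionProb, ← mul_pow, ← sphericalCoord_update_castSucc, Function.update_eq_self]

theorem sinProdBefore_ne_zero (hα : ∀ i p, α i p ∈ Set.Ioo 0 (Real.pi / 2)) (i : S)
    (p : Fin (d i)) : sinProdBefore (α i) p ≠ 0 := by
  refine Finset.prod_ne_zero_iff.2 fun k _ => ?_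
  split_ifs
  exacts [(sin_pos_of_angle hα i k).ne', one_ne_zero]

/-- With B the product of the preceding sines, the normaliser of the phantom law is sin²B² and the
probability of `p.castSucc` is cos²B²; their ratio is tan². -/
theorem phantomLaw_mul_eq (hα : ∀ i p, α i p ∈ Set.Ioo 0 (Real.pi / 2)) (i : S) (p : Fin (d i))
    {a : Fin (d i + 1)} (ha : p.val + 1 ≤ a.val) :
    phantomLaw α i p a * (Real.tan (α i p) ^ 2 * actionProb α i p.castSucc) =
      actionProb α i a := by
  rw [phantomLaw, if_pos ha, prod_sin_sq_eq, actionProb_castSucc, Real.tan_eq_sin_div_cos]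
  have := sin_pos_of_angle hα i p
  have := cos_pos_of_angle hα i p
  have := sinProdBefore_ne_zero hα i p
  field_simp

/-- The probability at `p.castSucc` is a multiple of cos², all later ones are multiples of sin². The
total flow of mass is 2 sin cos B² = 2 tan · cos²B², split among later actions in proportion to
their probabilities. -/
theorem hasDerivAt_actionProb [DecidableEq S] (hα : ∀ i p, α i p ∈ Set.Ioo 0 (Real.pi / 2))
    (i : S) (p : Fin (d i)) (a : Fin (d i + 1)) :
    HasDerivAt (fun x => actionProb (Function.update α i (Function.update (α i) p x)) i a)
      (2 * Real.tan (α i p) * actionProb α i p.castSucc *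
        (phantomLaw α i p a - if a = p.castSucc then 1 else 0)) (α i p) := by
  have hs := sin_pos_of_angle hα i p
  have hc := cos_pos_of_angle hα i p
  have hB := sinProdBefore_ne_zero hα i p
  simp only [actionProb, Function.update_self]
  change HasDerivAt _ (_ * actionProb α i p.castSucc * _) _
  rw [actionProb_castSucc, Real.tan_eq_sin_div_cos]
  rcases lt_trichotomy a.val p.val with ha | ha | ha
  · simp only [sphericalCoord_update_of_lt _ _ _ ha]
    refine (hasDerivAt_const (α i p) (sphericalCoord (α i) a ^ 2)).congr_deriv ?_
    rw [phantomLaw, if_neg (by omega), if_neg (fun h => by subst h; simp at ha)]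
    ring
  · obtain rfl : a = p.castSucc := Fin.ext ha
    simp only [sphericalCoord_update_castSucc]
    refine (((Real.hasDerivAt_cos (α i p)).mul_const (sinProdBefore (α i) p)).fun_pow 2).congr_deriv ?_
    rw [phantomLaw, if_neg (by simp), if_pos trivial]
    field_simp
    norm_num
    ring
  · obtain ⟨R, hR⟩ := exists_sphericalCoord_update_of_gt (α i) p ha
    simp only [hR]
    refine (((Real.hasDerivAt_sin (α i p)).mul_const R).fun_pow 2).congr_deriv ?_
    have hRa : actionProb α i a = (Real.sin (α i p) * R) ^ 2 := by
      rw [actionProb, ← hR, Function.update_eq_self]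
    rw [phantomLaw, if_pos (by omega), if_neg (fun h => by subst h; simp at ha), prod_sin_sq_eq,
      hRa]
    field_simp
    norm_num
    ring

theorem IsPositiveControlledLaw.isPositiveStochastic [Fintype S]
    {A : (i : S) → Fin (d i + 1) → S → ℝ} (hA : IsPositiveControlledLaw A)
    (hα : ∀ i p, α i p ∈ Set.Ioo 0 (Real.pi / 2)) : IsPositiveStochastic (transProb A α) where
  pos z z' := mul_pos (actionProb_pos hα _ _) (hA.pos _ _ _)
  sum_eq_one z := by
    rw [Fintype.sum_sigma]
    simp only [transProb, ← Finset.sum_mul, sum_actionProb, one_mul, hA.sum_eq_one]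

end ActionProb

/-! ### Derivative of the stationary cost -/

section Derivative

open Filter Topology

/-- At a zero of g the product rule needs only continuity of f, so the invariant law need not be
differentiated. -/
theorem HasDerivAt.continuousAt_mul_of_eq_zero {f g : ℝ → ℝ} {x g' : ℝ} (hf : ContinuousAt f x)
    (hg : HasDerivAt g g' x) (h0 : g x = 0) : HasDerivAt (fun y => f y * g y) (f x * g') x := by
  rw [hasDerivAt_iff_tendsto_slope] at hg ⊢
  refine ((hf.tendsto.mono_left nhdsWithin_le_nhds).mul hg).congr fun y => ?_
  simp only [slope_def_field, h0]
  ring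

variable {E : Type*} [Fintype E]

/-- Integrate the Poisson equation of P against ρ and replace ρ(h) by ρ(Qh). The identity is exact,
so it yields both continuity and differentiability of invariant means. -/
theorem invariant_mean_sub {P Q : E → E → ℝ} {π ρ : E → ℝ} (hρ : IsInvariantProb Q ρ)
    {f h : E → ℝ} (hh : ∀ z, h z - kernelApply P h z = f z - ∑ y, π y * f y) :
    ∑ z, ρ z * f z - ∑ z, π z * f z =
      ∑ z, ρ z * ∑ z', (Q z z' - P z z') * h z' := by
  have h1 := sum_invariant_mul_kernelApply hρ h
  have h2 : ∑ z, ρ z * (h z - kernelApply P h z) = ∑ z, ρ z * f z - ∑ z, π z * f z := by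
    simp only [hh, mul_sub, Finset.sum_sub_distrib, ← Finset.sum_mul, hρ.sum_eq_one, one_mul]
  rw [← h2]
  simp only [mul_sub, sub_mul, Finset.sum_sub_distrib]
  simp only [kernelApply] at h1 ⊢
  rw [h1]

/-- Derivative of the stationary mean of a function along a family of positive stochastic
matrices, in terms of a solution of the Poisson equation. -/
theorem hasDerivAt_invariant_mean [Nonempty E] {Q : ℝ → E → E → ℝ} {Q' : E → E → ℝ} {x₀ : ℝ}
    (hQ : ∀ᶠ x in 𝓝 x₀, IsPositiveStochastic (Q x))
    (hQ' : ∀ z z', HasDerivAt (fun x => Q x z z') (Q' z z') x₀) {f h : E → ℝ}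
    (hh : ∀ z, h z - kernelApply (Q x₀) h z = f z - ∑ y, invariantProb (Q x₀) y * f y) :
    HasDerivAt (fun x => ∑ z, invariantProb (Q x) z * f z)
      (∑ z, invariantProb (Q x₀) z * ∑ z', Q' z z' * h z') x₀ := by
  have hP := hQ.self_of_nhds
  have hR : ∀ (h : E → ℝ) z, HasDerivAt (fun x => ∑ z', (Q x z z' - Q x₀ z z') * h z')
      (∑ z', Q' z z' * h z') x₀ := fun h z =>
    HasDerivAt.fun_sum fun z' _ => ((hQ' z z').sub_const _).mul_const _
  -- The perturbation identity for the indicator of w: the invariant weights are at most 1 and the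
  -- matrix increments tend to 0.
  have hcont : ∀ w, ContinuousAt (fun x => invariantProb (Q x) w) x₀ := fun w => by
    classical
    obtain ⟨g, hg⟩ := hP.exists_poisson hP.isInvariantProb_invariantProb (Pi.single w (1 : ℝ))
    have hsingle : ∀ x, ∑ z, invariantProb (Q x) z * (Pi.single w (1 : ℝ) : E → ℝ) z =
        invariantProb (Q x) w := fun x => by simp [Pi.single_apply]
    have hdiff : ∀ᶠ x in 𝓝 x₀, invariantProb (Q x) w - invariantProb (Q x₀) w =
        ∑ z, invariantProb (Q x) z * ∑ z', (Q x z z' - Q x₀ z z') * g z' := by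
      filter_upwards [hQ] with x hx
      rw [← invariant_mean_sub hx.isInvariantProb_invariantProb hg, hsingle, hsingle]
    have hbound : Tendsto (fun x => ∑ z, |∑ z', (Q x z z' - Q x₀ z z') * g z'|) (𝓝 x₀) (𝓝 0) := by
      have : ContinuousAt (fun x => ∑ z, |∑ z', (Q x z z' - Q x₀ z z') * g z'|) x₀ :=
        tendsto_finsetSum _ fun z _ => ((hR g z).continuousAt.tendsto).abs
      simpa [ContinuousAt] using this
    rw [ContinuousAt, tendsto_iff_norm_sub_tendsto_zero]
    refine squeeze_zero' (Eventually.of_forall fun _ => norm_nonneg _) ?_ hbound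
    filter_upwards [hQ, hdiff] with x hx hd
    rw [hd]
    refine (Finset.abs_sum_le_sum_abs _ _).trans (Finset.sum_le_sum fun z _ => ?_)
    have hi := hx.isInvariantProb_invariantProb
    have h1 : invariantProb (Q x) z ≤ 1 := by
      rw [← hi.sum_eq_one]
      exact Finset.single_le_sum (fun z _ => hi.nonneg z) (Finset.mem_univ z)
    rw [abs_mul, abs_of_nonneg (hi.nonneg z)]
    exact mul_le_of_le_one_left (abs_nonneg _) h1
  have hmain : HasDerivAt (fun x => ∑ z, invariantProb (Q x₀) z * f z +
      ∑ z, invariantProb (Q x) z * ∑ z', (Q x z z' - Q x₀ z z') * h z')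
      (∑ z, invariantProb (Q x₀) z * ∑ z', Q' z z' * h z') x₀ := by
    refine HasDerivAt.const_add _ (HasDerivAt.fun_sum fun z _ => ?_)
    exact HasDerivAt.continuousAt_mul_of_eq_zero (hcont z) (hR h z) (by simp)
  refine hmain.congr_of_eventuallyEq ?_
  filter_upwards [hQ] with x hx
  rw [← invariant_mean_sub hx.isInvariantProb_invariantProb hh]
  ring

variable {S : Type*} [Fintype S] {d : S → ℕ} {α : Angles d}
  {A : (i : S) → Fin (d i + 1) → S → ℝ}

theorem IsInvariantProb.eq_actionProb_mul {π : StateAction d → ℝ}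
    (hπ : IsInvariantProb (transProb A α) π) (i : S) (a : Fin (d i + 1)) :
    π ⟨i, a⟩ = actionProb α i a * ∑ z, π z * A z.1 z.2 i := by
  rw [← hπ.invariant ⟨i, a⟩, Finset.mul_sum]
  exact Finset.sum_congr rfl fun z _ => by simp only [transProb]; ring

/-- Only the action law in state i depends on the angle, and the stationary probability of reaching
i multiplies θ at `p.castSucc` to give the invariant mass of that pair. -/
theorem hasDerivAt_costAlong [DecidableEq S] (hA : IsPositiveControlledLaw A)
    (hα : ∀ i p, α i p ∈ Set.Ioo 0 (Real.pi / 2)) {c h : StateAction d → ℝ}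
    (hh : ∀ z, h z - kernelApply (transProb A α) h z = c z - stationaryCost A c α)
    (i : S) (p : Fin (d i)) :
    HasDerivAt (costAlong A c α i p)
      (2 * Real.tan (α i p) * invariantProb (transProb A α) ⟨i, p.castSucc⟩ *
        (∑ a, phantomLaw α i p a * h ⟨i, a⟩ - h ⟨i, p.castSucc⟩)) (α i p) := by
  have : Nonempty (StateAction d) := ⟨⟨i, 0⟩⟩
  set upd : ℝ → Angles d := fun x => Function.update α i (Function.update (α i) p x) with hupd
  have hupd0 : upd (α i p) = α := by simp [hupd]
  have hQ : ∀ᶠ x in 𝓝 (α i p), IsPositiveStochastic (transProb A (upd x)) := by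
    filter_upwards [Ioo_mem_nhds (hα i p).1 (hα i p).2] with x hx
    refine hA.isPositiveStochastic fun j q => ?_
    by_cases hj : j = i
    · subst hj
      simp only [hupd, Function.update_self]
      by_cases hq : q = p
      · subst hq; simpa using hx
      · rw [Function.update_of_ne hq]; exact hα j q
    · simp only [hupd, Function.update_of_ne hj]; exact hα j q
  set dA : StateAction d → ℝ :=
    fun z => deriv (fun x => actionProb (upd x) z.1 z.2) (α i p) with hdA
  have hdi : ∀ a, dA ⟨i, a⟩ = 2 * Real.tan (α i p) * actionProb α i p.castSucc *
      (phantomLaw α i p a - if a = p.castSucc then 1 else 0) := fun a =>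
    (hasDerivAt_actionProb hα i p a).deriv
  have hconst : ∀ j, j ≠ i → ∀ a, (fun x => actionProb (upd x) j a) = fun _ => actionProb α j a :=
    fun j hj a => funext fun x => by simp only [actionProb, hupd, Function.update_of_ne hj]
  have hdj : ∀ j, j ≠ i → ∀ a, dA ⟨j, a⟩ = 0 := fun j hj a => by
    simp only [hdA, hconst j hj, deriv_const]
  have hderiv : ∀ z, HasDerivAt (fun x => actionProb (upd x) z.1 z.2) (dA z) (α i p) := by
    rintro ⟨j, a⟩
    by_cases hj : j = i
    · subst hj
      exact (hasDerivAt_actionProb hα j p a).differentiableAt.hasDerivAt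
    · rw [hdj j hj]
      simp only [hconst j hj]
      exact hasDerivAt_const _ _
  have hQ' : ∀ z z', HasDerivAt (fun x => transProb A (upd x) z z')
      (dA z' * A z.1 z.2 z'.1) (α i p) := fun z z' => (hderiv z').mul_const _
  have key := hasDerivAt_invariant_mean hQ hQ' (f := c) (h := h) (by rw [hupd0]; exact hh)
  rw [hupd0] at key
  have hi := (hA.isPositiveStochastic hα).isInvariantProb_invariantProb
  refine key.congr_deriv ?_
  have hinner : ∀ z : StateAction d, ∑ z' : StateAction d, dA z' * A z.1 z.2 z'.1 * h z' =
      A z.1 z.2 i * ∑ a, dA ⟨i, a⟩ * h ⟨i, a⟩ := fun z => by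
    rw [Fintype.sum_sigma, Finset.sum_eq_single i]
    · rw [Finset.mul_sum]
      exact Finset.sum_congr rfl fun a _ => by ring
    · intro j _ hj
      exact Finset.sum_eq_zero fun a _ => by rw [hdj j hj]; ring
    · simp
  simp only [hinner, ← mul_assoc, ← Finset.sum_mul]
  rw [hi.eq_actionProb_mul]
  have hsum : ∑ a, dA ⟨i, a⟩ * h ⟨i, a⟩ = 2 * Real.tan (α i p) * actionProb α i p.castSucc *
      (∑ a, phantomLaw α i p a * h ⟨i, a⟩ - h ⟨i, p.castSucc⟩) := by
    simp only [hdi, mul_assoc, ← Finset.mul_sum, sub_mul, Finset.sum_sub_distrib, ite_mul, one_mul,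
      zero_mul, Finset.sum_ite_eq', Finset.mem_univ, if_true]
  rw [hsum]
  ring

/-- The state reached by a phantom that starts from `z` with mark `y`. -/
def phantomTarget (i : S) (p : Fin (d i)) (z : StateAction d) (y : Fin (d i + 1)) :
    StateAction d :=
  ⟨i, if p.val + 1 < d i then y
    else if z.2.val = p.val then p.succ
    else if z.2.val = p.val + 1 then p.castSucc
    else 0⟩

/-- The weak derivative of the stationary law, expressed with the weights and the phantoms. -/
theorem sum_weight_mul_eq [DecidableEq S] (hα : ∀ i p, α i p ∈ Set.Ioo 0 (Real.pi / 2))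
    {π : StateAction d → ℝ} (hπ : IsInvariantProb (transProb A α) π) (h : StateAction d → ℝ)
    (i : S) (p : Fin (d i)) (hφ : ∑ a, phantomLaw α i p a = 1) :
    ∑ z, ∑ y, π z * phantomLaw α i p y *
        (weight α i p z * (h z - h (phantomTarget i p z y))) =
      Real.tan (α i p) * π ⟨i, p.castSucc⟩ *
        (∑ a, phantomLaw α i p a * h ⟨i, a⟩ - h ⟨i, p.castSucc⟩) := by
  by_cases hp : p.val + 1 < d i
  · simp only [weight, phantomTarget, if_pos hp]
    rw [Finset.sum_eq_single ⟨i, p.castSucc⟩]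
    · have : h ⟨i, p.castSucc⟩ = ∑ y, phantomLaw α i p y * h ⟨i, p.castSucc⟩ := by
        rw [← Finset.sum_mul, hφ, one_mul]
      rw [this, ← Finset.sum_sub_distrib, Finset.mul_sum]
      refine Finset.sum_congr rfl fun y _ => ?_
      rw [← this, if_pos rfl]
      ring
    · intro z _ hz
      simp [hz]
    · simp
  · have hne : (⟨i, p.castSucc⟩ : StateAction d) ≠ ⟨i, p.succ⟩ := fun h => by
      have := congrArg Fin.val (eq_of_heq (Sigma.mk.inj h).2)
      simp at this
    have hsupp : ∀ a, a ≠ p.succ → phantomLaw α i p a = 0 := fun a ha => by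
      rw [phantomLaw, if_neg]
      intro hle
      refine ha (Fin.ext ?_)
      have := a.2
      simp only [Fin.val_succ]
      omega
    have hone : phantomLaw α i p p.succ = 1 := by
      rw [← hφ, Finset.sum_eq_single p.succ (fun a _ ha => hsupp a ha) (by simp)]
    have hsum : ∑ a, phantomLaw α i p a * h ⟨i, a⟩ = h ⟨i, p.succ⟩ := by
      rw [Finset.sum_eq_single p.succ (fun a _ ha => by rw [hsupp a ha, zero_mul]) (by simp), hone,
        one_mul]
    -- At the last angle the phantom law is a unit mass at `p.succ`, so θ there is tan² times θ at
    -- `p.castSucc`. The two swapped pairs then carry total mass π/cos², with π the mass at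
    -- `p.castSucc`, and the weight cos·sin becomes tan·π.
    have hsucc := phantomLaw_mul_eq hα i p (a := p.succ) (by simp)
    rw [hone, one_mul] at hsucc
    have hy : ∀ z, ∑ y, π z * phantomLaw α i p y *
        (weight α i p z * (h z - h (phantomTarget i p z y))) =
        π z * (weight α i p z * (h z - h (phantomTarget i p z 0))) := fun z => by
      have : ∀ y, phantomTarget i p z y = phantomTarget i p z 0 := fun y => by
        simp only [phantomTarget, if_neg hp]
      simp only [this, ← Finset.sum_mul, ← Finset.mul_sum, hφ, mul_one]
    simp only [hy]
    rw [← Finset.sum_subset (Finset.subset_univ {⟨i, p.castSucc⟩, ⟨i, p.succ⟩}),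
      Finset.sum_pair hne, hsum]
    · have h1 : phantomTarget i p (⟨i, p.castSucc⟩ : StateAction d) 0 = ⟨i, p.succ⟩ := by
        simp [phantomTarget, hp]
      have h2 : phantomTarget i p (⟨i, p.succ⟩ : StateAction d) 0 = ⟨i, p.castSucc⟩ := by
        simp [phantomTarget, hp]
      rw [h1, h2]
      simp only [weight, if_neg hp, if_true, if_neg hne, if_neg hne.symm]
      rw [hπ.eq_actionProb_mul, hπ.eq_actionProb_mul, ← hsucc]
      have hc := cos_pos_of_angle hα i p
      rw [Real.tan_eq_sin_div_cos]
      have hcs := Real.sin_sq_add_cos_sq (α i p)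
      field_simp
      linear_combination (h ⟨i, p.succ⟩ - h ⟨i, p.castSucc⟩) * (actionProb α i p.castSucc *
        (∑ z, π z * A z.1 z.2 i) * Real.sin (α i p)) * hcs
    · intro z _ hz
      simp only [Finset.mem_insert, Finset.mem_singleton, not_or] at hz
      simp [weight, hp, hz.1, hz.2]

end Derivative

/-! ### Stationary chains with independent marks -/

section MarkedChain

variable {E F : Type*} [Fintype E] [Fintype F] [MeasurableSpace E] [MeasurableSpace F]
  {Ω : Type*} [MeasurableSpace Ω]

/-- `Z` is a two-sided stationary Markov chain with transition matrix `P` and marginal `π`, and `Y`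
is a sequence of marks with marginal `φ`, independent of `Z`. -/
structure IsMarkedStationaryChain (P : E → E → ℝ) (π : E → ℝ) (φ : F → ℝ) (μ : Measure Ω)
    (Z : ℤ → Ω → E) (Y : ℤ → Ω → F) : Prop where
  measurable_chain : ∀ k, Measurable (Z k)
  measurable_mark : ∀ k, Measurable (Y k)
  chain_law : ∀ (k : ℤ) (l : ℕ) (z : ℕ → E),
    μ.real {ω | ∀ t ≤ l, Z (k + (t : ℤ)) ω = z t} =
      π (z 0) * ∏ t ∈ Finset.range l, P (z t) (z (t + 1))
  mark_law : ∀ (k : ℤ) (a : F), μ.real {ω | Y k ω = a} = φ a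
  indep : IndepFun (fun ω k => Z k ω) (fun ω k => Y k ω) μ

/-- The indicator that the chain has not visited the target `w (Z k) (Y k)` at the times
`k + 1, …, k + m`. -/
noncomputable def survival [DecidableEq E] (w : E → F → E) (Z : ℤ → Ω → E) (Y : ℤ → Ω → F)
    (k : ℤ) (m : ℕ) (ω : Ω) : ℝ :=
  ∏ s ∈ Finset.range m, if Z (k + ((s + 1 : ℕ) : ℤ)) ω = w (Z k ω) (Y k ω) then 0 else 1

/-- The first time after `k` at which the chain visits the target `w (Z k) (Y k)`, counted
from `k`. -/
noncomputable def firstHit (w : E → F → E) (Z : ℤ → Ω → E) (Y : ℤ → Ω → F) (k : ℤ) (ω : Ω) : ℕ :=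
  sInf {m : ℕ | 0 < m ∧ Z (k + (m : ℤ)) ω = w (Z k ω) (Y k ω)}

theorem integral_comp_eq_sum {T : Type*} [Fintype T] [MeasurableSpace T]
    [MeasurableSingletonClass T] {μ : Measure Ω} [IsFiniteMeasure μ] {W : Ω → T}
    (hW : Measurable W) (g : T → ℝ) :
    ∫ ω, g (W ω) ∂μ = ∑ t, μ.real (W ⁻¹' {t}) * g t := by
  have : Measurable g := .of_discrete
  rw [← integral_map hW.aemeasurable this.aestronglyMeasurable, integral_fintype .of_finite]
  refine Finset.sum_congr rfl fun t _ => ?_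
  rw [smul_eq_mul, map_measureReal_apply hW (measurableSet_singleton t)]

theorem exists_abs_le {T : Type*} [Finite T] (g : T → ℝ) : ∃ B, 0 ≤ B ∧ ∀ t, |g t| ≤ B := by
  cases nonempty_fintype T
  exact ⟨∑ t, |g t|, Finset.sum_nonneg fun _ _ => abs_nonneg _, fun t =>
    Finset.single_le_sum (f := fun t => |g t|) (fun _ _ => abs_nonneg _) (Finset.mem_univ t)⟩

theorem integrable_of_abs_le {μ : Measure Ω} [IsFiniteMeasure μ] {f : Ω → ℝ} (hf : Measurable f)
    {B : ℝ} (hB : ∀ ω, |f ω| ≤ B) : Integrable f μ :=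
  Integrable.of_bound hf.aestronglyMeasurable B (Filter.Eventually.of_forall hB)

namespace IsMarkedStationaryChain

variable {P : E → E → ℝ} {π : E → ℝ} {φ : F → ℝ} {μ : Measure Ω} {Z : ℤ → Ω → E} {Y : ℤ → Ω → F}

theorem mark_nonneg (hZ : IsMarkedStationaryChain P π φ μ Z Y) (y : F) : 0 ≤ φ y := by
  rw [← hZ.mark_law 0 y]; exact measureReal_nonneg

theorem marginal_nonneg (hZ : IsMarkedStationaryChain P π φ μ Z Y) (z : E) :
    0 ≤ π z := by
  have := hZ.chain_law 0 0 fun _ => z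
  simp only [Finset.range_zero, Finset.prod_empty, mul_one] at this
  rw [← this]; exact measureReal_nonneg

theorem measurable_survival [DiscreteMeasurableSpace E] [DiscreteMeasurableSpace F]
    [DecidableEq E] (w : E → F → E) (hZ : IsMarkedStationaryChain P π φ μ Z Y) (k : ℤ) (m : ℕ) :
    Measurable (survival w Z Y k m) := by
  refine Finset.measurable_prod _ fun s _ => ?_
  have h : Measurable fun q : E × E × F => if q.1 = w q.2.1 q.2.2 then (0 : ℝ) else 1 :=
    .of_discrete
  exact h.comp ((hZ.measurable_chain _).prodMk
    ((hZ.measurable_chain k).prodMk (hZ.measurable_mark k)))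

end IsMarkedStationaryChain

variable [DiscreteMeasurableSpace E] [DiscreteMeasurableSpace F]
  {P : E → E → ℝ} {π : E → ℝ} {φ : F → ℝ} {μ : Measure Ω} [IsProbabilityMeasure μ]
  {Z : ℤ → Ω → E} {Y : ℤ → Ω → F}

namespace IsMarkedStationaryChain

theorem sum_mark (hZ : IsMarkedStationaryChain P π φ μ Z Y) : ∑ y, φ y = 1 := by
  have := integral_comp_eq_sum (μ := μ) (hZ.measurable_mark 0) (fun _ => (1 : ℝ))
  simp only [integral_const, probReal_univ, smul_eq_mul, mul_one] at this
  rw [this]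
  exact Finset.sum_congr rfl fun y _ => (hZ.mark_law 0 y).symm

theorem real_mark_path (hZ : IsMarkedStationaryChain P π φ μ Z Y) (k : ℤ) (l : ℕ) (y : F)
    (z : ℕ → E) :
    μ.real {ω | Y k ω = y ∧ ∀ t ≤ l, Z (k + (t : ℤ)) ω = z t} =
      φ y * (π (z 0) * ∏ t ∈ Finset.range l, P (z t) (z (t + 1))) := by
  have hs : MeasurableSet {x : ℤ → E | ∀ t ≤ l, x (k + ((t : ℕ) : ℤ)) = z t} := by
    simp only [Set.ofPred_forall]
    exact MeasurableSet.iInter fun t => MeasurableSet.iInter fun _ =>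
      (measurable_pi_apply _) (measurableSet_singleton _)
  have ht : MeasurableSet ((fun x : ℤ → F => x k) ⁻¹' {y}) :=
    (measurable_pi_apply k) (measurableSet_singleton y)
  have h := hZ.indep.measure_inter_preimage_eq_mul _ _ hs ht
  rw [← hZ.chain_law, ← hZ.mark_law k y, mul_comm, measureReal_def, measureReal_def,
    measureReal_def, ← ENNReal.toReal_mul]
  refine congrArg ENNReal.toReal (Eq.trans (congrArg μ ?_) h)
  ext ω
  simp only [Set.mem_ofPred_eq, Set.mem_inter_iff, Set.mem_preimage, Set.mem_singleton_iff]
  exact and_comm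

/-- The Markov property. -/
theorem integral_markov (hZ : IsMarkedStationaryChain P π φ μ Z Y) (hP : IsPositiveStochastic P)
    (k : ℤ) (l : ℕ) (H : F → (Fin (l + 1) → E) → E → ℝ) :
    ∫ ω, H (Y k ω) (fun t => Z (k + (t.val : ℤ)) ω) (Z (k + ((l + 1 : ℕ) : ℤ)) ω) ∂μ =
      ∫ ω, kernelApply P (H (Y k ω) (fun t => Z (k + (t.val : ℤ)) ω)) (Z (k + (l : ℤ)) ω) ∂μ := by
  let W : Ω → F × (Fin (l + 1) → E) × E := fun ω =>
    (Y k ω, fun t => Z (k + (t.val : ℤ)) ω, Z (k + ((l + 1 : ℕ) : ℤ)) ω)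
  have hW : Measurable W := (hZ.measurable_mark k).prodMk
    ((measurable_pi_lambda _ fun t => hZ.measurable_chain _).prodMk (hZ.measurable_chain _))
  -- Only the factorisation matters: ρ is the joint law of the mark and the first l + 1 states, and
  -- the last step contributes a factor P. The auxiliary `ext` turns finite data into a path on ℕ,
  -- as `chain_law` expects.
  obtain ⟨ρ, hρ⟩ : ∃ ρ : F → (Fin (l + 1) → E) → ℝ, ∀ y x z,
      μ.real (W ⁻¹' {(y, x, z)}) = ρ y x * P (x (Fin.last l)) z := by
    let ext : (Fin (l + 1) → E) → E → ℕ → E := fun x z t =>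
      if h : t < l + 1 then x ⟨t, h⟩ else z
    refine ⟨fun y x => φ y * (π (x 0) * ∏ t : Fin l, P (x t.castSucc) (x t.succ)),
      fun y x z => ?_⟩
    have h := hZ.real_mark_path k (l + 1) y (ext x z)
    have h0 : ext x z 0 = x 0 := by simp [ext]
    have hl : ext x z l = x (Fin.last l) := by simp [ext, Fin.last]
    have hl1 : ext x z (l + 1) = z := by simp [ext]
    have hprod : ∏ t ∈ Finset.range l, P (ext x z t) (ext x z (t + 1)) =
        ∏ t : Fin l, P (x t.castSucc) (x t.succ) := by
      rw [Finset.prod_range]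
      refine Finset.prod_congr rfl fun t _ => ?_
      have h1 : ext x z t.val = x t.castSucc := by
        simp only [ext]
        rw [dif_pos (by omega)]; rfl
      have h2 : ext x z (t.val + 1) = x t.succ := by
        simp only [ext]
        rw [dif_pos (by omega)]; rfl
      rw [h1, h2]
    rw [Finset.prod_range_succ, h0, hl, hl1, hprod] at h
    rw [show φ y * (π (x 0) * ∏ t : Fin l, P (x t.castSucc) (x t.succ)) * P (x (Fin.last l)) z =
      φ y * (π (x 0) * ((∏ t : Fin l, P (x t.castSucc) (x t.succ)) * P (x (Fin.last l)) z)) by ring,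
      ← h]
    congr 1
    ext ω
    simp only [W, Set.mem_preimage, Set.mem_singleton_iff, Prod.mk.injEq, Set.mem_ofPred_eq]
    refine and_congr_right fun _ => ⟨fun ⟨hx, hz⟩ t ht => ?_, fun hx => ⟨funext fun t => ?_, ?_⟩⟩
    · by_cases htl : t < l + 1
      · simp only [ext, dif_pos htl]
        exact congrFun hx ⟨t, htl⟩
      · obtain rfl : t = l + 1 := by omega
        rw [hl1]; exact hz
    · have := hx t.val (by omega)
      simpa only [ext, dif_pos t.2, Fin.eta] using this
    · rw [hx (l + 1) le_rfl, hl1]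
  have h1 := integral_comp_eq_sum (μ := μ) hW fun q => H q.1 q.2.1 q.2.2
  have h2 := integral_comp_eq_sum (μ := μ) hW fun q =>
    kernelApply P (H q.1 q.2.1) (q.2.1 (Fin.last l))
  refine h1.trans (Eq.trans ?_ h2.symm)
  simp only [Fintype.sum_prod_type, hρ]
  refine Finset.sum_congr rfl fun y _ => Finset.sum_congr rfl fun x _ => ?_
  simp only [mul_assoc, ← Finset.mul_sum]
  rw [← Finset.sum_mul, hP.sum_eq_one, one_mul]
  rfl

theorem integral_chain_mark (hZ : IsMarkedStationaryChain P π φ μ Z Y) (k : ℤ) (g : E → F → ℝ) :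
    ∫ ω, g (Z k ω) (Y k ω) ∂μ = ∑ z, ∑ y, π z * φ y * g z y := by
  have hW : Measurable fun ω => (Z k ω, Y k ω) :=
    (hZ.measurable_chain k).prodMk (hZ.measurable_mark k)
  refine (integral_comp_eq_sum (μ := μ) hW fun q => g q.1 q.2).trans ?_
  rw [Fintype.sum_prod_type]
  refine Finset.sum_congr rfl fun z _ => Finset.sum_congr rfl fun y _ => ?_
  have h := hZ.real_mark_path k 0 y fun _ => z
  simp only [Finset.range_zero, Finset.prod_empty, mul_one] at h
  rw [mul_comm (π z), ← h]
  congr 2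
  ext ω
  simp only [Set.mem_preimage, Set.mem_singleton_iff, Prod.mk.injEq, Set.mem_ofPred_eq]
  constructor
  · rintro ⟨h1, h2⟩
    refine ⟨h2, fun t ht => ?_⟩
    obtain rfl : t = 0 := by omega
    simpa using h1
  · rintro ⟨h1, h2⟩
    exact ⟨by simpa using h2 0 le_rfl, h1⟩

variable [DecidableEq E] (w : E → F → E)

/-- Survival through m steps is a function of the mark and of the states up to time k + m, so it
passes through the conditional expectation of the next state. -/
theorem integral_survival_mul_succ (hZ : IsMarkedStationaryChain P π φ μ Z Y)
    (hP : IsPositiveStochastic P) (k : ℤ) (m : ℕ) (g : E → F → E → ℝ) :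
    ∫ ω, survival w Z Y k m ω * g (Z k ω) (Y k ω) (Z (k + ((m + 1 : ℕ) : ℤ)) ω) ∂μ =
      ∫ ω, survival w Z Y k m ω *
        kernelApply P (g (Z k ω) (Y k ω)) (Z (k + (m : ℤ)) ω) ∂μ := by
  have h := hZ.integral_markov hP k m fun y x z' =>
    (∏ s : Fin m, if x s.succ = w (x 0) y then (0 : ℝ) else 1) * g (x 0) y z'
  simp only [Fin.val_zero, Nat.cast_zero, add_zero, Fin.val_succ] at h
  simp only [survival, Finset.prod_range]
  rw [h]
  refine integral_congr_ae (Filter.Eventually.of_forall fun ω => ?_)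
  simp only [kernelApply, Finset.mul_sum]
  exact Finset.sum_congr rfl fun z _ => by ring

/-- The last survival factor, absorbed into g, turns the Markov kernel into the taboo kernel; this
peels off one step, hence the induction for all g. -/
theorem integral_survival_mul (hZ : IsMarkedStationaryChain P π φ μ Z Y)
    (hP : IsPositiveStochastic P) (k : ℤ) (m : ℕ) (g : E → F → E → ℝ) :
    ∫ ω, survival w Z Y k m ω * g (Z k ω) (Y k ω) (Z (k + (m : ℤ)) ω) ∂μ =
      ∑ z, ∑ y, π z * φ y * (tabooApply P (w z y))^[m] (g z y) z := by
  induction m generalizing g with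
  | zero =>
    simp only [survival, Finset.range_zero, Finset.prod_empty, one_mul, Nat.cast_zero, add_zero,
      Function.iterate_zero, id_eq]
    exact hZ.integral_chain_mark k fun z y => g z y z
  | succ m ih =>
    have h := hZ.integral_survival_mul_succ w hP k m fun z y z' =>
      if z' = w z y then 0 else g z y z'
    simp only [Function.iterate_succ_apply]
    rw [← ih fun z y => tabooApply P (w z y) (g z y)]
    refine Eq.trans ?_ h
    refine integral_congr_ae (Filter.Eventually.of_forall fun ω => ?_)
    simp only [survival, Finset.prod_range_succ]
    split_ifs <;> simp

theorem integral_survival_mul_succ_eq (hZ : IsMarkedStationaryChain P π φ μ Z Y)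
    (hP : IsPositiveStochastic P) (k : ℤ) (m : ℕ) (g : E → F → E → ℝ) :
    ∫ ω, survival w Z Y k m ω * g (Z k ω) (Y k ω) (Z (k + ((m + 1 : ℕ) : ℤ)) ω) ∂μ =
      ∑ z, ∑ y, π z * φ y * (tabooApply P (w z y))^[m] (kernelApply P (g z y)) z :=
  (hZ.integral_survival_mul_succ w hP k m g).trans
    (hZ.integral_survival_mul w hP k m fun z y => kernelApply P (g z y))

end IsMarkedStationaryChain

end MarkedChain

/-! ### Pathwise identities for hitting times -/

section Pathwise

variable {E F Ω : Type*} [DecidableEq E] {w : E → F → E} {Z : ℤ → Ω → E} {Y : ℤ → Ω → F}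
  {k : ℤ} {ω : Ω}

theorem survival_eq_one_iff {m : ℕ} : survival w Z Y k m ω = 1 ↔
    ∀ s, 0 < s → s ≤ m → Z (k + (s : ℤ)) ω ≠ w (Z k ω) (Y k ω) := by
  constructor
  · intro h s hs hsm heq
    obtain ⟨s, rfl⟩ : ∃ t, s = t + 1 := ⟨s - 1, by omega⟩
    rw [survival, Finset.prod_eq_zero (i := s) (Finset.mem_range.2 hsm) (by rw [if_pos heq])] at h
    exact zero_ne_one h
  · intro h
    exact Finset.prod_eq_one fun s hs =>
      if_neg (h (s + 1) s.succ_pos (Finset.mem_range.1 hs))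

theorem survival_eq_zero_or_one (m : ℕ) :
    survival w Z Y k m ω = 0 ∨ survival w Z Y k m ω = 1 := by
  by_cases h : ∃ s ∈ Finset.range m, Z (k + ((s + 1 : ℕ) : ℤ)) ω = w (Z k ω) (Y k ω)
  · obtain ⟨s, hs, h⟩ := h
    exact Or.inl (Finset.prod_eq_zero hs (if_pos h))
  · push Not at h
    exact Or.inr (Finset.prod_eq_one fun s hs => if_neg (h s hs))

theorem survival_nonneg (m : ℕ) : 0 ≤ survival w Z Y k m ω := by
  rcases survival_eq_zero_or_one (w := w) (Z := Z) (Y := Y) (k := k) (ω := ω) m with h | h <;>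
    simp [h]

theorem survival_le_one (m : ℕ) : survival w Z Y k m ω ≤ 1 := by
  rcases survival_eq_zero_or_one (w := w) (Z := Z) (Y := Y) (k := k) (ω := ω) m with h | h <;>
    simp [h]

theorem survival_eq_one_of_lt_firstHit {m : ℕ} (h : m < firstHit w Z Y k ω) :
    survival w Z Y k m ω = 1 :=
  survival_eq_one_iff.2 fun _ hs hsm heq =>
    Nat.notMem_of_lt_sInf (hsm.trans_lt h) ⟨hs, heq⟩

theorem firstHit_mem (h : ∃ m : ℕ, 0 < m ∧ Z (k + (m : ℤ)) ω = w (Z k ω) (Y k ω)) :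
    0 < firstHit w Z Y k ω ∧ Z (k + (firstHit w Z Y k ω : ℤ)) ω = w (Z k ω) (Y k ω) :=
  Nat.sInf_mem (s := {m : ℕ | 0 < m ∧ Z (k + (m : ℤ)) ω = w (Z k ω) (Y k ω)}) h

/-- The existence of a hit is essential: without one, `firstHit` is `sInf ∅ = 0` although every
survival indicator equals 1. -/
theorem ite_lt_firstHit (h : ∃ m : ℕ, 0 < m ∧ Z (k + (m : ℤ)) ω = w (Z k ω) (Y k ω)) (m : ℕ) :
    (if m < firstHit w Z Y k ω then (1 : ℝ) else 0) = survival w Z Y k m ω := by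
  split_ifs with hm
  · exact (survival_eq_one_of_lt_firstHit hm).symm
  · refine ((survival_eq_zero_or_one m).resolve_right fun h1 => ?_).symm
    have := firstHit_mem h
    exact survival_eq_one_iff.1 h1 _ this.1 (not_lt.1 hm) this.2

/-- True even without a hit: then `firstHit` is 0 and survival is constantly 1, so both sides
vanish. -/
theorem ite_firstHit_eq (m : ℕ) :
    (if firstHit w Z Y k ω = m + 1 then (1 : ℝ) else 0) =
      survival w Z Y k m ω - survival w Z Y k (m + 1) ω := by
  by_cases h : ∃ m : ℕ, 0 < m ∧ Z (k + (m : ℤ)) ω = w (Z k ω) (Y k ω)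
  · rw [← ite_lt_firstHit h, ← ite_lt_firstHit h]
    rcases lt_trichotomy (firstHit w Z Y k ω) (m + 1) with h1 | h1 | h1
    · rw [if_neg h1.ne, if_neg (by omega), if_neg (by omega), sub_zero]
    · rw [if_pos h1, if_pos (by omega), if_neg (by omega), sub_zero]
    · rw [if_neg h1.ne', if_pos (by omega), if_pos (by omega), sub_self]
  · have h0 : firstHit w Z Y k ω = 0 := Nat.sInf_eq_zero.2 (Or.inr
      (Set.eq_empty_iff_forall_notMem.2 fun m hm => h ⟨m, hm⟩))
    have h1 : ∀ m, survival w Z Y k m ω = 1 := fun m =>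
      survival_eq_one_iff.2 fun s hs _ heq => h ⟨s, hs, heq⟩
    rw [h0, h1, h1, if_neg (by omega), sub_self]

/-- The contribution at time `j` of the phantom started at time `k`, when it is rewarded by `f` up
to its death. -/
noncomputable def occupation (w : E → F → E) (Z : ℤ → Ω → E) (Y : ℤ → Ω → F) (K f : E → ℝ)
    (j k : ℤ) (ω : Ω) : ℝ :=
  K (Z k ω) * f (Z j ω) * if k < j ∧ j ≤ k + (firstHit w Z Y k ω : ℤ) then 1 else 0

/-- The weighted lifetime of the phantom started at time `k`, if it dies at time `j`. -/
noncomputable def lifetimeAt (w : E → F → E) (Z : ℤ → Ω → E) (Y : ℤ → Ω → F) (K : E → ℝ)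
    (j k : ℤ) (ω : Ω) : ℝ :=
  K (Z k ω) * if k + (firstHit w Z Y k ω : ℤ) = j then (firstHit w Z Y k ω : ℝ) else 0

variable {K f : E → ℝ} {j : ℤ}

theorem occupation_of_le (h : j ≤ k) : occupation w Z Y K f j k ω = 0 := by
  rw [occupation, if_neg (fun h' => by omega), mul_zero]

theorem lifetimeAt_of_le (h : j ≤ k) : lifetimeAt w Z Y K j k ω = 0 := by
  rw [lifetimeAt]
  split_ifs with h'
  · rw [show firstHit w Z Y k ω = 0 by omega, Nat.cast_zero, mul_zero]
  · rw [mul_zero]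

theorem occupation_eq_survival {m : ℕ}
    (h : ∃ n : ℕ, 0 < n ∧ Z (k + (n : ℤ)) ω = w (Z k ω) (Y k ω)) (hj : j = k + ((m + 1 : ℕ) : ℤ)) :
    occupation w Z Y K f j k ω = survival w Z Y k m ω * (K (Z k ω) * f (Z j ω)) := by
  rw [occupation, ← ite_lt_firstHit h, mul_comm]
  congr 1
  exact if_congr (by omega) rfl rfl

theorem lifetimeAt_eq_survival {m : ℕ} (hj : j = k + ((m + 1 : ℕ) : ℤ)) :
    lifetimeAt w Z Y K j k ω =
      ((m + 1 : ℕ) : ℝ) * (survival w Z Y k m ω * K (Z k ω) -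
        survival w Z Y k (m + 1) ω * K (Z k ω)) := by
  rw [lifetimeAt, ← sub_mul, ← ite_firstHit_eq]
  by_cases h : firstHit w Z Y k ω = m + 1
  · rw [if_pos h, if_pos (by omega), h]; ring
  · rw [if_neg h, if_neg (by omega)]; ring

end Pathwise

/-! ### Series over birth times -/

section Series

/-- Reindexes birth times k < j by the age m + 1 = j - k, so that geometric bounds in the age apply.
-/
theorem hasSum_int_iff_of_eq_zero {a : ℤ → ℝ} {j : ℤ} (h : ∀ k, j ≤ k → a k = 0) {s : ℝ} :
    HasSum a s ↔ HasSum (fun m : ℕ => a (j - ((m + 1 : ℕ) : ℤ))) s := by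
  refine (Function.Injective.hasSum_iff (g := fun m : ℕ => j - ((m + 1 : ℕ) : ℤ))
    (fun m n hmn => by simp only at hmn; omega) fun k hk => h k ?_).symm
  by_contra hlt
  exact hk ⟨(j - k - 1).toNat, by simp only; omega⟩

theorem summable_int_iff_of_eq_zero {a : ℤ → ℝ} {j : ℤ} (h : ∀ k, j ≤ k → a k = 0) :
    Summable a ↔ Summable (fun m : ℕ => a (j - ((m + 1 : ℕ) : ℤ))) :=
  ⟨fun ⟨s, hs⟩ => ⟨s, (hasSum_int_iff_of_eq_zero h).1 hs⟩,
    fun ⟨s, hs⟩ => ⟨s, (hasSum_int_iff_of_eq_zero h).2 hs⟩⟩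

/-- Summation by parts for a geometrically decreasing sequence. -/
theorem hasSum_succ_mul_sub {u : ℕ → ℝ} {B r : ℝ} (hr0 : 0 ≤ r) (hr1 : r < 1)
    (hu : ∀ m, |u m| ≤ B * r ^ m) :
    HasSum (fun m => ((m + 1 : ℕ) : ℝ) * (u m - u (m + 1))) (∑' m, u m) := by
  have hgeo := (summable_geometric_of_lt_one hr0 hr1).mul_left B
  have hlin : Summable fun m : ℕ => (m : ℝ) * r ^ m := by
    simpa using summable_pow_mul_geometric_of_norm_lt_one 1
      (show ‖r‖ < 1 by rwa [Real.norm_of_nonneg hr0])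
  have hsu : Summable u := Summable.of_norm_bounded hgeo hu
  have hsm : Summable fun m : ℕ => (m : ℝ) * u m := by
    refine Summable.of_norm_bounded (hlin.mul_left B) fun m => ?_
    rw [norm_mul, Real.norm_natCast, Real.norm_eq_abs]
    calc (m : ℝ) * |u m| ≤ m * (B * r ^ m) :=
          mul_le_mul_of_nonneg_left (hu m) (Nat.cast_nonneg m)
      _ = B * (m * r ^ m) := by ring
  -- The correction to u m is a difference of consecutive values of m · u m, which starts at 0 and
  -- tends to 0.
  have hterm : ∀ m : ℕ, ((m + 1 : ℕ) : ℝ) * (u m - u (m + 1)) =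
      u m + ((m : ℝ) * u m - ((m + 1 : ℕ) : ℝ) * u (m + 1)) := fun m => by push_cast; ring
  simp only [hterm]
  have h2 : HasSum (fun m : ℕ => (m : ℝ) * u m - ((m + 1 : ℕ) : ℝ) * u (m + 1)) 0 := by
    have hs := hsm.sub ((summable_nat_add_iff 1).2 hsm)
    rw [hs.hasSum_iff_tendsto_nat]
    simp only [Finset.sum_range_sub' fun m : ℕ => (m : ℝ) * u m]
    simpa using hsm.tendsto_atTop_zero.neg
  simpa using hsu.hasSum.add h2

end Series

/-! ### Integrability of random series -/

section Expectations

open Filter Topology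

variable {E F : Type*} [Fintype E] [Fintype F] [MeasurableSpace E] [MeasurableSpace F]
  {Ω : Type*} [MeasurableSpace Ω] [DiscreteMeasurableSpace E] [DiscreteMeasurableSpace F]
  {P : E → E → ℝ} {π : E → ℝ} {φ : F → ℝ} {μ : Measure Ω} [IsProbabilityMeasure μ]
  {Z : ℤ → Ω → E} {Y : ℤ → Ω → F} [DecidableEq E] (w : E → F → E)

/-- Measurability comes from almost sure convergence of finite partial sums, finiteness of the norm
from Tonelli. -/
theorem integrable_tsum_of_summable_integral_norm {ι : Type*} [Countable ι] {G : ι → Ω → ℝ}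
    (hG : ∀ k, Integrable (G k) μ) (hs : Summable fun k => ∫ ω, ‖G k ω‖ ∂μ)
    (hae : ∀ᵐ ω ∂μ, Summable fun k => G k ω) : Integrable (fun ω => ∑' k, G k ω) μ := by
  constructor
  · refine aestronglyMeasurable_of_tendsto_ae (u := (atTop : Filter (Finset ι)))
      (f := fun s ω => ∑ k ∈ s, G k ω) (fun s => ?_) ?_
    · exact Finset.aestronglyMeasurable_fun_sum s fun k _ => (hG k).1
    · filter_upwards [hae] with ω hω using hω.hasSum
  · have h1 : ∀ k, ∫⁻ ω, ‖G k ω‖ₑ ∂μ = ENNReal.ofReal (∫ ω, ‖G k ω‖ ∂μ) := fun k =>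
      (ofReal_integral_norm_eq_lintegral_enorm (hG k)).symm
    refine (lintegral_mono fun ω => enorm_tsum_le_tsum_enorm).trans_lt ?_
    rw [lintegral_tsum fun k => (hG k).1.enorm]
    simp only [h1]
    rw [← ENNReal.ofReal_tsum_of_nonneg (fun k => integral_nonneg fun ω => norm_nonneg _) hs]
    exact ENNReal.ofReal_lt_top

end Expectations

/-! ### Geometric tails and expected sums over phantoms -/

section Tails

open Filter Topology

variable {E F : Type*} [Fintype E] [Fintype F] [MeasurableSpace E] [MeasurableSpace F]
  {Ω : Type*} [MeasurableSpace Ω] [DiscreteMeasurableSpace E] [DiscreteMeasurableSpace F]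
  {P : E → E → ℝ} {π : E → ℝ} {φ : F → ℝ} {μ : Measure Ω} [IsProbabilityMeasure μ]
  {Z : ℤ → Ω → E} {Y : ℤ → Ω → F} [DecidableEq E] (w : E → F → E)

/-- Once birth k and death j are fixed, the lifetime can only be j - k, so the variable is bounded
although ν is not. -/
theorem exists_abs_lifetimeAt_le (K : E → ℝ) (Z : ℤ → Ω → E) (Y : ℤ → Ω → F) (j k : ℤ) :
    ∃ B, ∀ ω, |lifetimeAt w Z Y K j k ω| ≤ B := by
  obtain ⟨B, hB0, hB⟩ := exists_abs_le K
  refine ⟨B * |(j : ℝ) - k|, fun ω => ?_⟩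
  rw [lifetimeAt, abs_mul]
  refine mul_le_mul (hB _) ?_ (abs_nonneg _) hB0
  split_ifs with h
  · rw [← h]; push_cast; rw [add_sub_cancel_left]
  · simp

namespace IsMarkedStationaryChain

theorem sum_marginal (hZ : IsMarkedStationaryChain P π φ μ Z Y) :
    ∑ z, ∑ y, π z * φ y = 1 := by
  simpa using (hZ.integral_chain_mark 0 fun _ _ => (1 : ℝ)).symm

theorem abs_sum_tabooApply_le (hZ : IsMarkedStationaryChain P π φ μ Z Y)
    (hP : IsPositiveStochastic P) {r : ℝ} (hr0 : 0 ≤ r)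
    (hr : ∀ w z, ∑ z', P z z' * (if z' = w then 0 else 1) ≤ r)
    {g : E → F → E → ℝ} {B : ℝ} (hB : 0 ≤ B) (hg : ∀ z y z', |g z y z'| ≤ B) (m : ℕ) :
    |∑ z, ∑ y, π z * φ y * (tabooApply P (w z y))^[m] (g z y) z| ≤ B * r ^ m := by
  calc _ ≤ ∑ z, ∑ y, π z * φ y * (r ^ m * B) := by
        refine (Finset.abs_sum_le_sum_abs _ _).trans (Finset.sum_le_sum fun z _ => ?_)
        refine (Finset.abs_sum_le_sum_abs _ _).trans (Finset.sum_le_sum fun y _ => ?_)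
        have h0 := mul_nonneg (hZ.marginal_nonneg z) (hZ.mark_nonneg y)
        rw [abs_mul, abs_of_nonneg h0]
        exact mul_le_mul_of_nonneg_left
          (hP.abs_tabooApply_iterate_le hr0 hr hB (hg z y) _ m z) h0
    _ = B * r ^ m := by
        simp only [← Finset.sum_mul]
        rw [hZ.sum_marginal, one_mul, mul_comm]

theorem integral_survival_le (hZ : IsMarkedStationaryChain P π φ μ Z Y)
    (hP : IsPositiveStochastic P) {r : ℝ} (hr0 : 0 ≤ r)
    (hr : ∀ w z, ∑ z', P z z' * (if z' = w then 0 else 1) ≤ r) (k : ℤ) (m : ℕ) :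
    ∫ ω, survival w Z Y k m ω ∂μ ≤ r ^ m := by
  have h := hZ.integral_survival_mul w hP k m fun _ _ _ => 1
  simp only [mul_one] at h
  rw [h]
  refine (le_abs_self _).trans ?_
  simpa using hZ.abs_sum_tabooApply_le w hP hr0 hr (g := fun _ _ _ => 1) zero_le_one (by simp) m

theorem integrable_survival (hZ : IsMarkedStationaryChain P π φ μ Z Y) (k : ℤ) (m : ℕ) :
    Integrable (survival w Z Y k m) μ :=
  integrable_of_abs_le (B := 1) (hZ.measurable_survival w k m) fun _ => by
    rw [abs_of_nonneg (survival_nonneg m)]; exact survival_le_one m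

theorem real_survival_le (hZ : IsMarkedStationaryChain P π φ μ Z Y)
    (hP : IsPositiveStochastic P) {r : ℝ} (hr0 : 0 ≤ r)
    (hr : ∀ w z, ∑ z', P z z' * (if z' = w then 0 else 1) ≤ r) (k : ℤ) (m : ℕ) :
    μ.real (survival w Z Y k m ⁻¹' {1}) ≤ r ^ m := by
  have hs : MeasurableSet (survival w Z Y k m ⁻¹' {1}) :=
    hZ.measurable_survival w k m (measurableSet_singleton 1)
  rw [← integral_indicator_one hs]
  refine le_trans (le_of_eq ?_) (hZ.integral_survival_le w hP hr0 hr k m)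
  congr 1
  ext ω
  rcases survival_eq_zero_or_one (w := w) (Z := Z) (Y := Y) (k := k) (ω := ω) m with h | h
  · rw [h, Set.indicator_of_notMem]
    simp [h]
  · rw [h, Set.indicator_of_mem]
    · rfl
    · simp [h]

theorem ae_exists_hit [Nonempty E] (hZ : IsMarkedStationaryChain P π φ μ Z Y)
    (hP : IsPositiveStochastic P) :
    ∀ᵐ ω ∂μ, ∀ k : ℤ, ∃ m : ℕ, 0 < m ∧ Z (k + (m : ℤ)) ω = w (Z k ω) (Y k ω) := by
  obtain ⟨r, hr0, hr1, hr⟩ := hP.exists_taboo_bound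
  rw [ae_all_iff]
  intro k
  rw [ae_iff, ← measureReal_eq_zero_iff]
  refine le_antisymm (ge_of_tendsto' (tendsto_pow_atTop_nhds_zero_of_lt_one hr0 hr1) fun m =>
    le_trans (measureReal_mono fun ω hω => ?_) (hZ.real_survival_le w hP hr0 hr k m))
    measureReal_nonneg
  exact survival_eq_one_iff.2 fun s hs _ heq => hω ⟨s, hs, heq⟩

/-- Borel–Cantelli: a phantom born at j - m and still alive at j has survived m steps, an event of
probability at most r ^ m. -/
theorem ae_finite_living [Nonempty E] (hZ : IsMarkedStationaryChain P π φ μ Z Y)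
    (hP : IsPositiveStochastic P) (j : ℤ) :
    ∀ᵐ ω ∂μ, {k : ℤ | k ≤ j ∧ j < k + (firstHit w Z Y k ω : ℤ)}.Finite := by
  obtain ⟨r, hr0, hr1, hr⟩ := hP.exists_taboo_bound
  have hsum : ∑' m : ℕ, μ (survival w Z Y (j - (m : ℤ)) m ⁻¹' {1}) ≠ ⊤ := by
    refine ne_top_of_le_ne_top (ENNReal.ofReal_ne_top (r := ∑' m : ℕ, r ^ m)) ?_
    rw [ENNReal.ofReal_tsum_of_nonneg (fun m => by positivity)
      (summable_geometric_of_lt_one hr0 hr1)]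
    refine ENNReal.tsum_le_tsum fun m => ?_
    rw [← ofReal_measureReal]
    exact ENNReal.ofReal_le_ofReal (hZ.real_survival_le w hP hr0 hr _ m)
  filter_upwards [ae_finite_setOfPred_mem hsum] with ω hω
  refine (hω.image fun m : ℕ => j - (m : ℤ)).subset fun k hk => ?_
  refine ⟨(j - k).toNat, ?_, ?_⟩
  · have hk1 := hk.1
    have hk2 := hk.2
    have h1 : j - ((j - k).toNat : ℤ) = k := by omega
    change survival w Z Y (j - ((j - k).toNat : ℤ)) (j - k).toNat ω = 1
    rw [h1]
    exact survival_eq_one_of_lt_firstHit (by omega)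
  · have hk1 := hk.1
    simp only
    omega

theorem measurable_firstHit (hZ : IsMarkedStationaryChain P π φ μ Z Y) (k : ℤ) :
    Measurable (firstHit w Z Y k) := by
  have hsucc : ∀ m : ℕ, MeasurableSet (firstHit w Z Y k ⁻¹' {m + 1}) := fun m => by
    have : firstHit w Z Y k ⁻¹' {m + 1} =
        (fun ω => survival w Z Y k m ω - survival w Z Y k (m + 1) ω) ⁻¹' {1} := by
      ext ω
      simp only [Set.mem_preimage, Set.mem_singleton_iff, ← ite_firstHit_eq]
      simp
    rw [this]
    exact ((hZ.measurable_survival w k m).sub (hZ.measurable_survival w k (m + 1)))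
      (measurableSet_singleton 1)
  refine measurable_to_countable' fun m => ?_
  cases m with
  | succ m => exact hsucc m
  -- The default value 0 of `firstHit` has no survival formula and is handled as the complement of
  -- all positive values.
  | zero =>
    have : firstHit w Z Y k ⁻¹' {0} = (⋃ m : ℕ, firstHit w Z Y k ⁻¹' {m + 1})ᶜ := by
      ext ω
      simp only [Set.mem_preimage, Set.mem_singleton_iff, Set.mem_compl_iff, Set.mem_iUnion,
        not_exists]
      exact ⟨fun h m => by omega, fun h => by
        by_contra h0
        exact h (firstHit w Z Y k ω - 1) (by omega)⟩
    rw [this]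
    exact (MeasurableSet.iUnion hsucc).compl

theorem measurable_occupation (hZ : IsMarkedStationaryChain P π φ μ Z Y) (K f : E → ℝ)
    (j k : ℤ) : Measurable (occupation w Z Y K f j k) := by
  have h : Measurable fun q : E × E × ℕ => K q.1 * f q.2.1 *
      if k < j ∧ j ≤ k + (q.2.2 : ℤ) then (1 : ℝ) else 0 := .of_discrete
  exact h.comp ((hZ.measurable_chain k).prodMk
    ((hZ.measurable_chain j).prodMk (hZ.measurable_firstHit w k)))

theorem measurable_lifetimeAt (hZ : IsMarkedStationaryChain P π φ μ Z Y) (K : E → ℝ)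
    (j k : ℤ) : Measurable (lifetimeAt w Z Y K j k) := by
  have h : Measurable fun q : E × ℕ => K q.1 *
      if k + (q.2 : ℤ) = j then (q.2 : ℝ) else 0 := .of_discrete
  exact h.comp ((hZ.measurable_chain k).prodMk (hZ.measurable_firstHit w k))

theorem integrable_occupation (hZ : IsMarkedStationaryChain P π φ μ Z Y) (K f : E → ℝ)
    (j k : ℤ) : Integrable (occupation w Z Y K f j k) μ := by
  obtain ⟨B, hB0, hB⟩ := exists_abs_le fun q : E × E => K q.1 * f q.2
  refine integrable_of_abs_le (hZ.measurable_occupation w K f j k) (B := B) fun ω => ?_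
  rw [occupation, abs_mul]
  refine (mul_le_of_le_one_right (abs_nonneg _) ?_).trans (hB (Z k ω, Z j ω))
  split_ifs <;> simp

theorem integral_abs_occupation_le [Nonempty E] (hZ : IsMarkedStationaryChain P π φ μ Z Y)
    (hP : IsPositiveStochastic P) {r : ℝ} (hr0 : 0 ≤ r)
    (hr : ∀ w z, ∑ z', P z z' * (if z' = w then 0 else 1) ≤ r) {K f : E → ℝ} {B : ℝ}
    (hB0 : 0 ≤ B) (hB : ∀ z z', |K z * f z'| ≤ B) {j k : ℤ} {m : ℕ}
    (hj : j = k + ((m + 1 : ℕ) : ℤ)) :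
    ∫ ω, |occupation w Z Y K f j k ω| ∂μ ≤ B * r ^ m := by
  calc ∫ ω, |occupation w Z Y K f j k ω| ∂μ ≤ ∫ ω, B * survival w Z Y k m ω ∂μ := by
        refine integral_mono_ae (hZ.integrable_occupation w K f j k).abs
          ((hZ.integrable_survival w k m).const_mul B) ?_
        filter_upwards [hZ.ae_exists_hit w hP] with ω hω
        rw [occupation_eq_survival (hω k) hj, abs_mul, abs_of_nonneg (survival_nonneg m), mul_comm]
        exact mul_le_mul_of_nonneg_right (hB _ _) (survival_nonneg m)
    _ ≤ B * r ^ m := by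
        rw [integral_const_mul]
        exact mul_le_mul_of_nonneg_left (hZ.integral_survival_le w hP hr0 hr k m) hB0

theorem summable_integral_abs_occupation [Nonempty E]
    (hZ : IsMarkedStationaryChain P π φ μ Z Y) (hP : IsPositiveStochastic P) (K f : E → ℝ)
    (j : ℤ) : Summable fun k => ∫ ω, |occupation w Z Y K f j k ω| ∂μ := by
  obtain ⟨r, hr0, hr1, hr⟩ := hP.exists_taboo_bound
  obtain ⟨B, hB0, hB⟩ := exists_abs_le fun q : E × E => K q.1 * f q.2
  rw [summable_int_iff_of_eq_zero (j := j) fun k hk => by simp [occupation_of_le hk]]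
  refine Summable.of_nonneg_of_le (fun m => integral_nonneg fun ω => abs_nonneg _) (fun m => ?_)
    ((summable_geometric_of_lt_one hr0 hr1).mul_left B)
  exact hZ.integral_abs_occupation_le w hP hr0 hr hB0 (fun z z' => hB (z, z')) (by ring)

/-- The expected total reward of a phantom, as a sum over the starting times. -/
theorem hasSum_integral_occupation [Nonempty E] (hZ : IsMarkedStationaryChain P π φ μ Z Y)
    (hP : IsPositiveStochastic P) (K : E → ℝ) {f : E → ℝ} {s : E → F → ℝ}
    (hs : ∀ z y, HasSum (fun m => (tabooApply P (w z y))^[m] (kernelApply P f) z) (s z y))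
    (j : ℤ) :
    HasSum (fun k => ∫ ω, occupation w Z Y K f j k ω ∂μ)
      (∑ z, ∑ y, π z * φ y * (K z * s z y)) := by
  rw [hasSum_int_iff_of_eq_zero (j := j) fun k hk => by simp [occupation_of_le hk]]
  -- The right-hand side does not involve j: by stationarity only the age matters, so summing over
  -- births at fixed j is summing over the ages of one phantom.
  have hterm : ∀ m : ℕ, ∫ ω, occupation w Z Y K f j (j - ((m + 1 : ℕ) : ℤ)) ω ∂μ =
      ∑ z, ∑ y, π z * φ y * (K z * (tabooApply P (w z y))^[m] (kernelApply P f) z) := fun m => by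
    have h := hZ.integral_survival_mul_succ_eq w hP (j - ((m + 1 : ℕ) : ℤ)) m
      fun z _ z' => K z * f z'
    rw [sub_add_cancel] at h
    refine Eq.trans (integral_congr_ae ?_) (h.trans ?_)
    · filter_upwards [hZ.ae_exists_hit w hP] with ω hω
      exact occupation_eq_survival (hω _) (by ring)
    · refine Finset.sum_congr rfl fun z _ => Finset.sum_congr rfl fun y _ => ?_
      have : kernelApply P (fun z' => K z * f z') = K z • kernelApply P f := by
        ext z'
        simp only [kernelApply, Pi.smul_apply, smul_eq_mul, Finset.mul_sum]
        exact Finset.sum_congr rfl fun _ _ => by ring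
      rw [this, tabooApply_iterate_smul]
      rfl
  simp only [hterm]
  exact hasSum_sum fun z _ => hasSum_sum fun y _ => ((hs z y).mul_left _).mul_left _

/-- The expected lifetime can be computed by summing over the phantoms that are alive at a given
time or over those that die at a given time. -/
theorem hasSum_integral_lifetimeAt [Nonempty E] (hZ : IsMarkedStationaryChain P π φ μ Z Y)
    (hP : IsPositiveStochastic P) (K : E → ℝ) (j : ℤ) :
    HasSum (fun k => ∫ ω, lifetimeAt w Z Y K j k ω ∂μ)
      (∑' m : ℕ, ∑ z, ∑ y, π z * φ y * (tabooApply P (w z y))^[m] (fun _ => K z) z) := by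
  obtain ⟨r, hr0, hr1, hr⟩ := hP.exists_taboo_bound
  obtain ⟨B, hB0, hB⟩ := exists_abs_le K
  rw [hasSum_int_iff_of_eq_zero (j := j) fun k hk => by simp [lifetimeAt_of_le hk]]
  have hint : ∀ k m, Integrable (fun ω => survival w Z Y k m ω * K (Z k ω)) μ := fun k m => by
    refine integrable_of_abs_le (B := B) ((hZ.measurable_survival w k m).mul
      ((Measurable.of_discrete (f := K)).comp (hZ.measurable_chain k))) fun ω => ?_
    rw [abs_mul, abs_of_nonneg (survival_nonneg m)]
    exact (mul_le_of_le_one_left (abs_nonneg _) (survival_le_one m)).trans (hB _)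
  convert hasSum_succ_mul_sub hr0 hr1 (fun m => hZ.abs_sum_tabooApply_le w hP hr0 hr
    (g := fun z _ _ => K z) hB0 (fun z _ _ => hB z) m) using 2 with m
  rw [← hZ.integral_survival_mul w hP (j - ((m + 1 : ℕ) : ℤ)) m fun z _ _ => K z,
    ← hZ.integral_survival_mul w hP (j - ((m + 1 : ℕ) : ℤ)) (m + 1) fun z _ _ => K z,
    ← integral_sub (hint _ _) (hint _ _), ← integral_const_mul]
  refine integral_congr_ae (Eventually.of_forall fun ω => ?_)
  exact lifetimeAt_eq_survival (by ring)

/-- Tail-sum counterpart of `hasSum_integral_lifetimeAt`: a phantom of age m + 1 is counted when it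
survived m steps, so both series have the same sum κ. -/
theorem hasSum_integral_occupation_one [Nonempty E] (hZ : IsMarkedStationaryChain P π φ μ Z Y)
    (hP : IsPositiveStochastic P) (K : E → ℝ) (j : ℤ) :
    HasSum (fun k => ∫ ω, occupation w Z Y K (fun _ => 1) j k ω ∂μ)
      (∑' m : ℕ, ∑ z, ∑ y, π z * φ y * (tabooApply P (w z y))^[m] (fun _ => K z) z) := by
  obtain ⟨r, hr0, hr1, hr⟩ := hP.exists_taboo_bound
  obtain ⟨B, hB0, hB⟩ := exists_abs_le K
  rw [hasSum_int_iff_of_eq_zero (j := j) fun k hk => by simp [occupation_of_le hk]]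
  have hsum : Summable fun m : ℕ =>
      ∑ z, ∑ y, π z * φ y * (tabooApply P (w z y))^[m] (fun _ => K z) z :=
    Summable.of_norm_bounded ((summable_geometric_of_lt_one hr0 hr1).mul_left B) fun m =>
      hZ.abs_sum_tabooApply_le w hP hr0 hr (g := fun z _ _ => K z) hB0 (fun z _ _ => hB z) m
  convert hsum.hasSum using 2 with m
  rw [← hZ.integral_survival_mul w hP (j - ((m + 1 : ℕ) : ℤ)) m fun z _ _ => K z]
  refine integral_congr_ae ?_
  filter_upwards [hZ.ae_exists_hit w hP] with ω hω
  rw [occupation_eq_survival (m := m) (hω _) (by ring), mul_one]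

/-- The absolute value of the weighted lifetime is the lifetime weighted by |K|, whose expectations
are already known to be summable. -/
theorem summable_integral_abs_lifetimeAt_mul [Nonempty E]
    (hZ : IsMarkedStationaryChain P π φ μ Z Y) (hP : IsPositiveStochastic P) (K : E → ℝ)
    {G : Ω → ℝ} {B : ℝ} (hGB : ∀ ω, |G ω| ≤ B) (j : ℤ) :
    Summable fun k => ∫ ω, |lifetimeAt w Z Y K j k ω * G ω| ∂μ := by
  have hB0 : 0 ≤ B := by
    obtain ⟨ω⟩ : Nonempty Ω := (nonempty_of_isProbabilityMeasure μ)
    exact (abs_nonneg _).trans (hGB ω)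
  have hlt := (hZ.hasSum_integral_lifetimeAt w hP (fun z => |K z|) j).summable.mul_right B
  refine Summable.of_nonneg_of_le (fun k => integral_nonneg fun ω => abs_nonneg _) (fun k => ?_)
    hlt
  obtain ⟨B', hB'⟩ := exists_abs_lifetimeAt_le w (fun z => |K z|) Z Y j k
  have hi := integrable_of_abs_le (μ := μ) (hZ.measurable_lifetimeAt w (fun z => |K z|) j k) hB'
  have habs : ∀ ω, |lifetimeAt w Z Y K j k ω| = lifetimeAt w Z Y (fun z => |K z|) j k ω :=
    fun ω => by
      rw [lifetimeAt, lifetimeAt, abs_mul]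
      congr 1
      split_ifs <;> simp
  rw [← integral_mul_const]
  refine integral_mono_of_nonneg (Eventually.of_forall fun ω => abs_nonneg _) (hi.mul_const B)
    (Eventually.of_forall fun ω => ?_)
  simp only [abs_mul]
  rw [← habs]
  exact mul_le_mul_of_nonneg_left (hGB ω) (abs_nonneg _)

end IsMarkedStationaryChain

end Tails

/-! ### The batch estimator as a series over all birth times -/

section Batch

variable {S : Type*} {d : S → ℕ}

instance : DiscreteMeasurableSpace (StateAction d) where
  forall_measurableSet s := by
    refine MeasurableSpace.measurableSet_iInf.2 fun i => ?_
    exact (MeasurableSet.of_discrete : MeasurableSet (Sigma.mk i ⁻¹' s))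

theorem card_batch (N : ℕ) (n : ℤ) : (batch N n).card = N := by
  rw [batch, Int.card_Icc]
  have : (n + 1) * (N : ℤ) + 1 - (n * N + 1) = N := by ring
  rw [this, Int.toNat_natCast]

variable {Ω : Type*} [DecidableEq S] {α : Angles d} {c : StateAction d → ℝ} {i : S} {p : Fin (d i)}
  {N : ℕ} {Γ : (Fin N → StateAction d) → ℝ} {n : ℤ} {Z : ℤ → Ω → StateAction d}
  {Y : ℤ → Ω → Fin (d i + 1)} {k : ℤ} {ω : Ω}

theorem hittingTime_eq_firstHit :
    hittingTime i p Z Y k ω = firstHit (phantomTarget i p) Z Y k ω := rfl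

theorem sum_lifetimeAt_batch :
    ∑ j ∈ batch N n, lifetimeAt (phantomTarget i p) Z Y (weight α i p) j k ω =
      weight α i p (Z k ω) * (if k + (hittingTime i p Z Y k ω : ℤ) ∈ batch N n
        then (hittingTime i p Z Y k ω : ℝ) else 0) := by
  simp only [lifetimeAt, ← Finset.mul_sum, Finset.sum_ite_eq, hittingTime_eq_firstHit]
  congr

/-- The weighted gain of phantom `k` during batch `n`. -/
noncomputable def batchGain (c : StateAction d → ℝ) (α : Angles d) (i : S) (p : Fin (d i))
    (Γ : (Fin N → StateAction d) → ℝ) (n : ℤ) (Z : ℤ → Ω → StateAction d)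
    (Y : ℤ → Ω → Fin (d i + 1)) (k : ℤ) (ω : Ω) : ℝ :=
  ∑ j ∈ batch N n, occupation (phantomTarget i p) Z Y (weight α i p) c j k ω -
    ∑ j ∈ batch N n, lifetimeAt (phantomTarget i p) Z Y (weight α i p) j k ω *
      batchCostEstimator Γ n Z ω

/-- Newborn phantoms start collecting at k + 1 and older ones at nN + 1; both are max(k, nN) + 1, so
one formula covers the two sums of the estimator. -/
theorem weight_mul_phantomGain {s : ℤ} (hs : s = max k (n * N) + 1) :
    weight α i p (Z k ω) * phantomGain c i p Γ n Z Y k s ω = batchGain c α i p Γ n Z Y k ω := by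
  rw [batchGain, ← Finset.sum_mul, sum_lifetimeAt_batch, phantomGain, mul_sub]
  congr 1
  · simp only [occupation, mul_assoc, ← Finset.mul_sum]
    simp only [mul_ite, mul_one, mul_zero]
    rw [← Finset.sum_filter]
    congr 2
    ext j
    simp only [batch, Finset.mem_Icc, Finset.mem_filter, hs, hittingTime_eq_firstHit]
    omega
  · split_ifs <;> ring

theorem batchGain_eq_zero (hk : k ∉ batch N n) (hk' : k ∉ livingPhantoms i p Z Y (n * N) ω) :
    batchGain c α i p Γ n Z Y k ω = 0 := by
  have hk'' : ¬ (k ≤ n * N ∧ n * N < k + (firstHit (phantomTarget i p) Z Y k ω : ℤ)) := hk'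
  simp only [batch, Finset.mem_Icc] at hk
  rw [batchGain, Finset.sum_eq_zero, Finset.sum_eq_zero, sub_zero]
  · intro j hj
    simp only [batch, Finset.mem_Icc] at hj
    by_cases hjk : j ≤ k
    · rw [lifetimeAt_of_le hjk, zero_mul]
    · rw [lifetimeAt, if_neg (by omega), mul_zero, zero_mul]
  · intro j hj
    simp only [batch, Finset.mem_Icc] at hj
    rw [occupation, if_neg (by omega), mul_zero]

/-- Replaces the random set of living phantoms by the fixed index set ℤ, since all other phantoms
contribute zero; expectations can then be taken term by term. -/
theorem hasSum_batchGain (hL : (livingPhantoms i p Z Y (n * N) ω).Finite) :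
    HasSum (fun k => batchGain c α i p Γ n Z Y k ω)
      (∑ k ∈ batch N n, weight α i p (Z k ω) * phantomGain c i p Γ n Z Y k (k + 1) ω +
        ∑' k : livingPhantoms i p Z Y (n * N) ω, weight α i p (Z k ω) *
          phantomGain c i p Γ n Z Y k (n * N + 1) ω) := by
  have h1 : ∑ k ∈ batch N n, weight α i p (Z k ω) * phantomGain c i p Γ n Z Y k (k + 1) ω =
      ∑ k ∈ batch N n, batchGain c α i p Γ n Z Y k ω :=
    Finset.sum_congr rfl fun k hk => weight_mul_phantomGain (by
      simp only [batch, Finset.mem_Icc] at hk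
      rw [max_eq_left (by omega)])
  have h2 : ∑' k : livingPhantoms i p Z Y (n * N) ω, weight α i p (Z k ω) *
      phantomGain c i p Γ n Z Y k (n * N + 1) ω =
      ∑ k ∈ hL.toFinset, batchGain c α i p Γ n Z Y k ω := by
    have : ∀ k : livingPhantoms i p Z Y (n * N) ω, weight α i p (Z k ω) *
        phantomGain c i p Γ n Z Y k (n * N + 1) ω = batchGain c α i p Γ n Z Y k ω := fun k =>
      weight_mul_phantomGain (by rw [max_eq_right k.2.1])
    rw [tsum_congr this, tsum_subtype (livingPhantoms i p Z Y (n * N) ω)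
      fun k => batchGain c α i p Γ n Z Y k ω, tsum_eq_sum (s := hL.toFinset)]
    · exact Finset.sum_congr rfl fun k hk => Set.indicator_of_mem (hL.mem_toFinset.1 hk) _
    · intro k hk
      exact Set.indicator_of_notMem (fun h => hk (hL.mem_toFinset.2 h)) _
  rw [h1, h2, ← Finset.sum_union]
  · refine hasSum_sum_of_ne_finset_zero fun k hk => ?_
    rw [Finset.mem_union, not_or, hL.mem_toFinset] at hk
    exact batchGain_eq_zero hk.1 hk.2
  · rw [Finset.disjoint_left]
    intro k hk hk'
    have := (hL.mem_toFinset.1 hk').1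
    simp only [batch, Finset.mem_Icc] at hk
    omega

theorem fastPhantomEstimator_eq (hL : (livingPhantoms i p Z Y (n * N) ω).Finite) :
    fastPhantomEstimator c α i p Γ n Z Y ω = 2 / (N : ℝ) *
      (∑ k ∈ batch N n, weight α i p (Z k ω) *
        (c (Z k ω) - c (phantomTarget i p (Z k ω) (Y k ω))) +
      ∑' k, batchGain c α i p Γ n Z Y k ω) := by
  rw [(hasSum_batchGain hL).tsum_eq, fastPhantomEstimator, ← add_assoc, ← Finset.sum_add_distrib]
  simp only [← mul_add]
  rfl

end Batch

/-! ### Assembly of the bias formula -/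

section Main

variable {S : Type*} [Fintype S] {d : S → ℕ}
  {A : (i : S) → Fin (d i + 1) → S → ℝ} {α : Angles d} {i : S} {p : Fin (d i)}
  {Ω : Type*} [MeasurableSpace Ω] {μ : Measure Ω}
  {Z : ℤ → Ω → StateAction d} {Y : ℤ → Ω → Fin (d i + 1)}

theorem IsStationaryPhantomSystem.isMarkedStationaryChain
    (h : IsStationaryPhantomSystem A α i p μ Z Y) :
    IsMarkedStationaryChain (transProb A α) (invariantProb (transProb A α)) (phantomLaw α i p)
      μ Z Y :=
  ⟨h.measurable_chain, h.measurable_phantom, h.chain_law, h.phantom_law, h.chain_indep_phantom⟩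

theorem measurable_batchCostEstimator (hZ : ∀ k, Measurable (Z k)) {N : ℕ}
    (Γ : (Fin N → StateAction d) → ℝ) (n : ℤ) : Measurable (batchCostEstimator Γ n Z) :=
  (Measurable.of_discrete (f := Γ)).comp (measurable_pi_lambda _ fun _ => hZ _)

end Main

end PhantomMDP

open PhantomMDP

theorem mainTheorem4 {S : Type*} [Fintype S] [DecidableEq S] (d : S → ℕ)
    (A : (i : S) → Fin (d i + 1) → S → ℝ) (hA : PhantomMDP.IsPositiveControlledLaw A)
    (c : PhantomMDP.StateAction d → ℝ)
    (α : PhantomMDP.Angles d) (hα : ∀ i p, α i p ∈ Set.Ioo 0 (Real.pi / 2))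
    (i : S) (p : Fin (d i))
    {Ω : Type*} [MeasurableSpace Ω] (μ : Measure Ω) [IsProbabilityMeasure μ]
    (Z : ℤ → Ω → PhantomMDP.StateAction d) (Y : ℤ → Ω → Fin (d i + 1))
    (hZY : PhantomMDP.IsStationaryPhantomSystem A α i p μ Z Y)
    (N : ℕ) (hN : 1 ≤ N) (n : ℤ)
    (Γ : (Fin N → PhantomMDP.StateAction d) → ℝ)
    (hΓ : ∫ ω, PhantomMDP.batchCostEstimator Γ n Z ω ∂μ = PhantomMDP.stationaryCost A c α) :
    -- almost surely all phantoms die, and finitely many are living at the start of the batch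
    (∀ᵐ ω ∂μ,
      (∀ k : ℤ, ∃ m : ℕ, 0 < m ∧
        Z (k + (m : ℤ)) ω = ⟨i, PhantomMDP.phantomAction i p Z Y k ω⟩) ∧
      (PhantomMDP.livingPhantoms i p Z Y (n * N) ω).Finite) ∧
    Integrable (PhantomMDP.fastPhantomEstimator c α i p Γ n Z Y) μ ∧
    DifferentiableAt ℝ (PhantomMDP.costAlong A c α i p) (α i p) ∧
    -- the bias
    HasSum
      (fun k : ℤ => -(2 / (N : ℝ)) *
        cov[fun ω => PhantomMDP.weight α i p (Z k ω) *
              (if k + (PhantomMDP.hittingTime i p Z Y k ω : ℤ) ∈ PhantomMDP.batch N n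
                then (PhantomMDP.hittingTime i p Z Y k ω : ℝ) else 0),
            PhantomMDP.batchCostEstimator Γ n Z; μ])
      (∫ ω, PhantomMDP.fastPhantomEstimator c α i p Γ n Z Y ω ∂μ -
        deriv (PhantomMDP.costAlong A c α i p) (α i p)) := by
  have : Nonempty (StateAction d) := ⟨⟨i, 0⟩⟩
  have hP := hA.isPositiveStochastic hα
  have hπ := hP.isInvariantProb_invariantProb
  have hC := hZY.isMarkedStationaryChain
  set w : StateAction d → Fin (d i + 1) → StateAction d := phantomTarget i p with hw
  set K := weight α i p with hK
  set G := batchCostEstimator Γ n Z with hGdef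
  set C := stationaryCost A c α with hCost
  obtain ⟨h, hh⟩ := hP.exists_poisson hπ c
  have hlive : ∀ᵐ ω ∂μ, (livingPhantoms i p Z Y (n * N) ω).Finite :=
    hC.ae_finite_living w hP (n * N)
  -- the data of the estimator
  have hGm : Measurable G := measurable_batchCostEstimator hZY.measurable_chain Γ n
  obtain ⟨B, hB0, hB⟩ := exists_abs_le Γ
  have hGB : ∀ ω, |G ω| ≤ B := fun ω => hB _
  -- the two series
  have hO := fun j k => hC.integrable_occupation w K c j k
  have hD : ∀ j k, Integrable (lifetimeAt w Z Y K j k) μ := fun j k => by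
    obtain ⟨B', hB'⟩ := exists_abs_lifetimeAt_le w K Z Y j k
    exact integrable_of_abs_le (hC.measurable_lifetimeAt w K j k) hB'
  have hDG : ∀ j k, Integrable (fun ω => lifetimeAt w Z Y K j k ω * G ω) μ := fun j k =>
    (hD j k).mul_bdd hGm.aestronglyMeasurable (Filter.Eventually.of_forall hGB)
  -- κ is the mean weighted lifetime; below, R is the mean initial contribution and V the mean
  -- weighted sum of c - C over a phantom's life.
  set κ := ∑' m : ℕ, ∑ z, ∑ y, invariantProb (transProb A α) z * phantomLaw α i p y *
    (tabooApply (transProb A α) (w z y))^[m] (fun _ => K z) z with hκ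
  set R := ∑ z, ∑ y, invariantProb (transProb A α) z * phantomLaw α i p y *
    (K z * (c z - c (w z y))) with hR
  set V := ∑ z, ∑ y, invariantProb (transProb A α) z * phantomLaw α i p y *
    (K z * (kernelApply (transProb A α) h z - kernelApply (transProb A α) h (w z y))) with hV
  -- Split c as (c - C) + C: the centred part has the Poisson potential h and gives V, the constant
  -- part gives Cκ.
  have hocc : ∀ j, HasSum (fun k => ∫ ω, occupation w Z Y K c j k ω ∂μ) (V + C * κ) := fun j => by
    have h1 := hC.hasSum_integral_occupation w hP K (f := fun z => c z - C)
      (fun z y => hP.hasSum_tabooApply_iterate hh (w z y) z) j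
    have h2 := (hC.hasSum_integral_occupation_one w hP K j).mul_left C
    refine (h1.add h2).congr_fun fun k => ?_
    rw [← integral_const_mul, ← integral_add (hC.integrable_occupation w K _ j k)
      ((hC.integrable_occupation w K _ j k).const_mul C)]
    refine integral_congr_ae (Filter.Eventually.of_forall fun ω => ?_)
    simp only [occupation]
    ring
  have hgain_int : ∀ k, Integrable (batchGain c α i p Γ n Z Y k) μ := fun k =>
    (integrable_finsetSum _ fun j _ => hO j k).sub (integrable_finsetSum _ fun j _ => hDG j k)
  have hgain_sum : Summable fun k => ∫ ω, ‖batchGain c α i p Γ n Z Y k ω‖ ∂μ := by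
    refine Summable.of_nonneg_of_le (fun k => integral_nonneg fun ω => norm_nonneg _) (fun k => ?_)
      ((summable_sum (s := batch N n) fun j _ =>
        hC.summable_integral_abs_occupation w hP K c j).add
      (summable_sum (s := batch N n) fun j _ =>
        hC.summable_integral_abs_lifetimeAt_mul w hP K hGB j))
    rw [← integral_finsetSum _ fun j _ => (hO j k).abs,
      ← integral_finsetSum _ fun j _ => (hDG j k).abs,
      ← integral_add (integrable_finsetSum _ fun j _ => (hO j k).abs)
        (integrable_finsetSum _ fun j _ => (hDG j k).abs)]
    refine integral_mono (hgain_int k).norm ((integrable_finsetSum _ fun j _ => (hO j k).abs).add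
        (integrable_finsetSum _ fun j _ => (hDG j k).abs)) fun ω => ?_
    exact (abs_sub _ _).trans
      (add_le_add (Finset.abs_sum_le_sum_abs _ _) (Finset.abs_sum_le_sum_abs _ _))
  have hgain := hasSum_integral_of_summable_integral_norm hgain_int hgain_sum
  have hgain_tsum : Integrable (fun ω => ∑' k, batchGain c α i p Γ n Z Y k ω) μ :=
    integrable_tsum_of_summable_integral_norm hgain_int hgain_sum <| by
      filter_upwards [hlive] with ω hω using (hasSum_batchGain hω).summable
  -- the estimator
  have hstart : ∀ k, Integrable (fun ω => K (Z k ω) * (c (Z k ω) - c (w (Z k ω) (Y k ω)))) μ :=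
    fun k => by
      obtain ⟨B', -, hB'⟩ := exists_abs_le fun q : StateAction d × Fin (d i + 1) =>
        K q.1 * (c q.1 - c (w q.1 q.2))
      refine integrable_of_abs_le ((Measurable.of_discrete
        (f := fun q : StateAction d × Fin (d i + 1) => K q.1 * (c q.1 - c (w q.1 q.2)))).comp
        ((hZY.measurable_chain k).prodMk (hZY.measurable_phantom k))) fun ω => hB' (Z k ω, Y k ω)
  have hest : fastPhantomEstimator c α i p Γ n Z Y =ᵐ[μ] fun ω => 2 / (N : ℝ) *
      (∑ k ∈ batch N n, K (Z k ω) * (c (Z k ω) - c (w (Z k ω) (Y k ω))) +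
        ∑' k, batchGain c α i p Γ n Z Y k ω) := by
    filter_upwards [hlive] with ω hω using fastPhantomEstimator_eq hω
  have hstart_sum := integrable_finsetSum (batch N n) fun k _ => hstart k
  have hest_int : ∫ ω, fastPhantomEstimator c α i p Γ n Z Y ω ∂μ =
      2 / (N : ℝ) * (N * R + ∫ ω, ∑' k, batchGain c α i p Γ n Z Y k ω ∂μ) := by
    rw [integral_congr_ae hest, integral_const_mul, integral_add hstart_sum hgain_tsum,
      integral_finsetSum _ fun k _ => hstart k]
    have : ∀ k, ∫ ω, K (Z k ω) * (c (Z k ω) - c (w (Z k ω) (Y k ω))) ∂μ = R := fun k =>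
      hC.integral_chain_mark k fun z y => K z * (c z - c (w z y))
    simp only [this, Finset.sum_const, card_batch, nsmul_eq_mul]
  -- the derivative
  have hderiv := hasDerivAt_costAlong hA hα (c := c) (h := h) hh i p
  -- Substituting h = c - C + Ph at the phantom's two endpoints, the constant C cancels and the
  -- difference of h splits into the parts R and V.
  have hderiv_eq : deriv (costAlong A c α i p) (α i p) = 2 * (R + V) := by
    rw [hderiv.deriv, mul_assoc (2 : ℝ), mul_assoc (2 : ℝ), ← sum_weight_mul_eq hα hπ h i p
      hC.sum_mark, hR, hV, ← Finset.sum_add_distrib]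
    refine congrArg (2 * ·) (Finset.sum_congr rfl fun z _ => ?_)
    rw [← Finset.sum_add_distrib]
    refine Finset.sum_congr rfl fun y _ => ?_
    have h1 := hh z
    have h2 := hh (w z y)
    have h3 : h z - h (w z y) = c z - c (w z y) + (kernelApply (transProb A α) h z -
        kernelApply (transProb A α) h (w z y)) := by linarith
    rw [← hw, ← hK, h3]
    ring
  refine ⟨?_, (((hstart_sum.add hgain_tsum).const_mul _).congr hest.symm),
    hderiv.differentiableAt, ?_⟩
  · filter_upwards [hC.ae_exists_hit w hP, hlive] with ω h1 h2 using ⟨h1, h2⟩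
  -- the covariances
  have hlife : HasSum (fun k => ∑ j ∈ batch N n, ∫ ω, lifetimeAt w Z Y K j k ω ∂μ) (N * κ) := by
    have := hasSum_sum (s := batch N n) fun j _ => hC.hasSum_integral_lifetimeAt w hP K j
    simpa only [Finset.sum_const, card_batch, nsmul_eq_mul] using this
  have hoccs : HasSum (fun k => ∑ j ∈ batch N n, ∫ ω, occupation w Z Y K c j k ω ∂μ)
      (N * (V + C * κ)) := by
    have := hasSum_sum (s := batch N n) fun j _ => hocc j
    simpa only [Finset.sum_const, card_batch, nsmul_eq_mul] using this
  -- The mean of lifetime times Γ is recovered as occupation minus gain; unbiasedness turns the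
  -- product of means into a multiple of C.
  have hcov : ∀ k, cov[fun ω => K (Z k ω) *
      (if k + (hittingTime i p Z Y k ω : ℤ) ∈ batch N n
        then (hittingTime i p Z Y k ω : ℝ) else 0), G; μ] =
      ∑ j ∈ batch N n, ∫ ω, occupation w Z Y K c j k ω ∂μ -
        ∫ ω, batchGain c α i p Γ n Z Y k ω ∂μ -
        (∑ j ∈ batch N n, ∫ ω, lifetimeAt w Z Y K j k ω ∂μ) * C := fun k => by
    simp only [hK, ← sum_lifetimeAt_batch]
    simp only [← hK, ← hw]
    rw [covariance_eq_sub]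
    · rw [hΓ, integral_finsetSum _ fun j _ => hD j k]
      congr 1
      rw [← integral_finsetSum _ fun j _ => hO j k,
        ← integral_sub (integrable_finsetSum _ fun j _ => hO j k) (hgain_int k)]
      refine integral_congr_ae (Filter.Eventually.of_forall fun ω => ?_)
      simp only [Pi.mul_apply, batchGain, Finset.sum_mul, ← hw, ← hK, ← hGdef]
      ring
    · refine memLp_finsetSum _ fun j _ => ?_
      obtain ⟨B', hB'⟩ := exists_abs_lifetimeAt_le w K Z Y j k
      exact MemLp.of_bound (hC.measurable_lifetimeAt w K j k).aestronglyMeasurable B'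
        (Filter.Eventually.of_forall hB')
    · exact MemLp.of_bound hGm.aestronglyMeasurable B (Filter.Eventually.of_forall hGB)
  simp only [hcov]
  rw [hest_int, hderiv_eq]
  have hN0 : (N : ℝ) ≠ 0 := by exact_mod_cast (by omega : N ≠ 0)
  -- The term NCκ from the occupation sum cancels NκC from the product of means; the total gain I
  -- stays arbitrary, since its value is never needed.
  have hlim : ∀ I : ℝ, 2 / (N : ℝ) * (N * R + I) - 2 * (R + V) =
      -(2 / (N : ℝ)) * (N * (V + C * κ) - I - N * κ * C) := fun I => by
    field_simp
    ring
  rw [hlim]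
  exact ((hoccs.sub hgain).sub (hlife.mul_right C)).mul_left _
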